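/- Let $\rho,\alpha\in(0,1)$. A lender with discount factor $\rho$ faces a consumer whose periodic income $\theta$ is drawn once from the symmetric Beta distribution $\mathrm{Beta}(a,a)$, $a>0$, which has mean $\tfrac12$ and variance $v(a)=\frac{1}{4(2a+1)}\in(0,\tfrac14)$, and is unknown to the lender. In each period $t=0,1,2,\dots$ in which the consumer is still in the system, the lender offers a repayment amount $y_t\ge 0$ at a discount rate $d_t\in[0,\rho]$. The consumer accepts with probability $s(d_t)=d_t^{\alpha}$ (constant demand elasticity $d\,s'(d)/s(d)=\alpha$) and leaves otherwise; if she accepts, she receives $d_ty_t$ and, one period later, pays back $y_t$ if $\theta\ge y_t$, while if $\theta<y_t$ she pays nothing and leaves. The lender's expected NPV under the policy $(\mathbf y,\mathbf d)$ is $$\Pi_a(\mathbf y,\mathbf d)=\sum_{t=0}^{\infty}\rho^{t}\Big[\prod_{i<t}P_i\,s(d_i)\Big]\big(\rho\, s(d_t)P_t\,y_t-s(d_t)\,d_t\,y_t\big),\qquad P_t=\mathbb P_a\big(\theta\ge y_t \,\big|\, \theta\ge y_i\text{ for all } i<t\big),$$ where $P_t$ is read as $0$ if the conditioning event has probability $0$.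 This series always converges. For every $a>0$ the maximum $V(a)=\max_{(\mathbf y,\mathbf d)}\Pi_a(\mathbf y,\mathbf d)$ over all policies is attained. Moreover $V$ is U-shaped as a function of the income variance: there is $v_0\in(0,\tfrac14)$ such that, as the variance $v(a)=\frac{1}{4(2a+1)}$ increases, $V$ is strictly decreasing for variances in $(0,v_0]$ and strictly increasing for variances in $[v_0,\tfrac14)$. -/

import Mathlib

open MeasureTheory ProbabilityTheory

noncomputable section

/-- A dynamic lending policy of a lender with discount factor `ρ`: in period `t`, a consumer who is
still in the system is offered a loan with repayment amount `repay t` at the discount rate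
`disc t`, that is, a loan of size `disc t * repay t`. -/
structure LendingPolicy (ρ : ℝ) where
  repay : ℕ → ℝ
  disc : ℕ → ℝ
  repay_nonneg : ∀ t, 0 ≤ repay t
  disc_mem : ∀ t, disc t ∈ Set.Icc 0 ρ

namespace LendingPolicy

variable {ρ : ℝ}

/-- The incomes compatible with the history at time `t` of a consumer who has repaid all the
loans of the periods before `t`. -/
def history (p : LendingPolicy ρ) (t : ℕ) : Set ℝ :=
  {θ | ∀ i < t, p.repay i ≤ θ}

/-- The conditional probability, given the history at time `t`, that the income, which has
law `μ`, suffices to repay the loan of period `t`. -/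
def repayProb (p : LendingPolicy ρ) (μ : Measure ℝ) (t : ℕ) : ℝ :=
  (cond μ (p.history t)).real (Set.Ici (p.repay t))

/-- The discounted expected cash flow of the loan of period `t`, for the demand function `s`: with
probability `∏ i < t, repayProb i * s (disc i)` the consumer is still in the system; she accepts
the loan with probability `s (disc t)`, in which case the lender pays `disc t * repay t` now and
receives `repay t` one period later if the income suffices, and nothing otherwise. -/
def cashFlow (p : LendingPolicy ρ) (s : ℝ → ℝ) (μ : Measure ℝ) (t : ℕ) : ℝ :=
  ρ ^ t * (∏ i ∈ Finset.range t, p.repayProb μ i * s (p.disc i)) *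
    (ρ * s (p.disc t) * p.repayProb μ t * p.repay t
      - s (p.disc t) * p.disc t * p.repay t)

/-- The lender's expected net present value under the policy. -/
def expectedNPV (p : LendingPolicy ρ) (s : ℝ → ℝ) (μ : Measure ℝ) : ℝ :=
  ∑' t, p.cashFlow s μ t

end LendingPolicy

/-- The lender's optimal expected net present value. -/
def optimalNPV (ρ : ℝ) (s : ℝ → ℝ) (μ : Measure ℝ) : ℝ :=
  ⨆ p : LendingPolicy ρ, p.expectedNPV s μ

/-- The demand function with constant elasticity `α`: `d * s' d / s d = α`, with `s 1 = 1`. -/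
def constElasticityDemand (α : ℝ) : ℝ → ℝ := fun d => d ^ α

/-- The symmetric Beta law of income. -/
def symmBeta (a : ℝ) : Measure ℝ := betaMeasure a a

/-- The variance of the symmetric Beta law of income. -/
def incomeVar (a : ℝ) : ℝ := variance id (symmBeta a)

end

section

/-! ### Power inequalities -/

/-! Weighting each cash flow by the probability that the consumer has repaid so far makes the value
of a fixed policy linear in the survival function `G` of income. From a record `m`, jumping to `y`
and repeating it forever is worth `K * G m ^ (-α) * (y * G y ^ (1 + α))`, so the natural target is
the mode `z` of `y * G y ^ (1 + α)`. For symmetric Beta laws this function is unimodal because the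
generalized failure rate increases (`generalizedFailureRate_lt`, `exists_hasPeak_symmBeta`).

The Bellman equation shows that some optimal policy makes finitely many loss-making screening loans
below a threshold `m₁ < z` and then stays at `z`. Screening loans enter with nonpositive
coefficients, so (`exists_plan`) the value is `-e - ∑ cᵢ G(uᵢ) + P G(z)` with `cᵢ ≥ 0` and `uᵢ < m₁
< z`. The same expression is a lower bound for the value under any other survival function, so laws
can be compared with the plan held fixed.

If `z ≥ 1/2`, a smaller parameter multiplies `G(z)` by a factor that is at least `1` and at least
the factor of every `G(uᵢ)`; the value rises (`optValue_lt_of_half_le`). If `z < 1/2`, take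
parameters `b < a < c`: a combination of the distribution functions with signs `+`, `-`, `+` is
nonnegative at all `uᵢ` and negative at `z`, so the value at `a` lies below one of the values at `b`
and `c` (`optValue_lt_or_lt_of_lt_half`). Hence the value is strictly quasiconvex in the parameter.

It is also lower semicontinuous, smallest at the right end of `(0, 1/4]`, and not decreasing
throughout: it never exceeds `K / 2`, which is approached as income concentrates at `1/2`.
`exists_minimizer_of_strictQuasiconvex` then gives the U-shape, and the variance is a decreasing
function of the parameter. -/

lemma young_rpow_lt {α d u : ℝ} (hα : 0 < α) (hd : 0 ≤ d) (hu : 0 ≤ u) (hne : d ≠ u) :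
    (1 + α) * d ^ α * u < α * d ^ (1 + α) + u ^ (1 + α) := by
  rcases hd.eq_or_lt with rfl | hd
  · have hu' : 0 < u := lt_of_le_of_ne hu hne
    rw [Real.zero_rpow hα.ne', Real.zero_rpow (by positivity)]
    have := Real.rpow_pos_of_pos hu' (1 + α)
    linarith
  · have h1 : u / d - 1 ≠ 0 := by
      intro h
      have : u / d = 1 := by linarith
      exact hne ((div_eq_one_iff_eq hd.ne').1 this).symm
    have h2 : -1 ≤ u / d - 1 := by
      have : 0 ≤ u / d := by positivity
      linarith
    have h3 := one_add_mul_self_lt_rpow_one_add h2 h1 (p := 1 + α) (by linarith)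
    rw [show 1 + (u / d - 1) = u / d by ring, Real.div_rpow hu hd.le,
      lt_div_iff₀ (Real.rpow_pos_of_pos hd _), Real.rpow_one_add' hd.le (by positivity)] at h3
    rw [Real.rpow_one_add' hd.le (by positivity)]
    have h4 : (1 + (1 + α) * (u / d - 1)) * (d * d ^ α)
        = (1 + α) * d ^ α * u - α * (d * d ^ α) := by
      field_simp
      ring
    linarith

lemma young_rpow_le {α d u : ℝ} (hα : 0 < α) (hd : 0 ≤ d) (hu : 0 ≤ u) :
    (1 + α) * d ^ α * u ≤ α * d ^ (1 + α) + u ^ (1 + α) := by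
  rcases eq_or_ne d u with rfl | h
  · rw [Real.rpow_one_add' hd (by positivity)]
    apply le_of_eq
    ring
  · exact (young_rpow_lt hα hd hu h).le

/-- With `A` the expected receipts and `B` the funds per unit of discount rate, `e` solves the
first-order condition for maximizing `d ^ α * (A - d * B)`. Optimality of `e` is exactly the Young
inequality above. -/
lemma profit_le {α d e A B : ℝ} (hα : 0 < α) (hd : 0 ≤ d) (he : 0 ≤ e) (hB : 0 ≤ B)
    (hA : α * A = (1 + α) * e * B) : d ^ α * (A - d * B) ≤ B * e ^ (1 + α) / α := by
  have h := young_rpow_le hα hd he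
  rw [le_div_iff₀ hα]
  have hdd : d ^ (1 + α) = d * d ^ α := Real.rpow_one_add' hd (by positivity)
  have : d ^ α * (A - d * B) * α = B * ((1 + α) * d ^ α * e - α * d ^ (1 + α)) := by
    rw [hdd]
    linear_combination d ^ α * hA
  rw [this]
  exact mul_le_mul_of_nonneg_left (by linarith) hB

lemma profit_eq {α e A B : ℝ} (hα : 0 < α) (he : 0 ≤ e)
    (hA : α * A = (1 + α) * e * B) : e ^ α * (A - e * B) = B * e ^ (1 + α) / α := by
  have hee : e ^ (1 + α) = e * e ^ α := Real.rpow_one_add' he (by positivity)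
  rw [eq_div_iff hα.ne', hee]
  linear_combination e ^ α * hA

/-- The hypothesis `hA` says that `d'` does not exceed the unconstrained maximizer, and profit
increases up to there. -/
lemma profit_strictMono {α d d' A B : ℝ} (hα : 0 < α) (hd : 0 ≤ d) (hdd : d < d')
    (hB : 0 < B) (hA : (1 + α) * d' * B ≤ α * A) :
    d ^ α * (A - d * B) < d' ^ α * (A - d' * B) := by
  have hd' : 0 ≤ d' := hd.trans hdd.le
  have h := young_rpow_lt hα hd hd' hdd.ne
  have h1 : d ^ (1 + α) = d * d ^ α := Real.rpow_one_add' hd (by positivity)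
  have h2 : d' ^ (1 + α) = d' * d' ^ α := Real.rpow_one_add' hd' (by positivity)
  have hm : d ^ α ≤ d' ^ α := Real.rpow_le_rpow hd hdd.le hα.le
  rw [h1, h2] at h
  have h3 := mul_lt_mul_of_pos_left h hB
  have h4 := mul_le_mul_of_nonneg_left hA (sub_nonneg.2 hm)
  have : 0 < α * (d' ^ α * (A - d' * B) - d ^ α * (A - d * B)) := by nlinarith
  have := pos_of_mul_pos_right this hα.le
  linarith

/-- The stationary discount rate `δ` and the value `K`, per unit of repayment, of a consumer who
is known to repay. -/
structure StationaryLoan (ρ α δ K : ℝ) : Prop where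
  rho_pos : 0 < ρ
  rho_lt_one : ρ < 1
  alpha_pos : 0 < α
  alpha_lt_one : α < 1
  disc_pos : 0 < δ
  disc_lt : δ < ρ
  mul_value : α * K = δ ^ (1 + α)
  firstOrder : α * (ρ * (1 + K)) = (1 + α) * δ

lemma exists_stationaryLoan {ρ α : ℝ} (hρ : ρ ∈ Set.Ioo (0 : ℝ) 1) (hα : α ∈ Set.Ioo (0 : ℝ) 1) :
    ∃ δ K, StationaryLoan ρ α δ K := by
  obtain ⟨hρ0, hρ1⟩ := hρ
  obtain ⟨hα0, hα1⟩ := hα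
  have hc : ContinuousOn (fun δ : ℝ => (1 + α) * δ - ρ * (α + δ ^ (1 + α))) (Set.Icc 0 ρ) := by
    have : Continuous fun δ : ℝ => δ ^ (1 + α) := Real.continuous_rpow_const (by positivity)
    fun_prop
  have hlt : ρ ^ (1 + α) < 1 := Real.rpow_lt_one hρ0.le hρ1 (by positivity)
  have := intermediate_value_Ioo hρ0.le hc
  -- Substituting `K = δ ^ (1 + α) / α` into the first-order condition leaves one equation in `δ`;
  -- its left side is `-ρ * α` at `0` and `ρ * (1 - ρ ^ (1 + α))` at `ρ`.
  obtain ⟨δ, hδ, h⟩ := this (show (0 : ℝ) ∈ _ by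
    constructor
    · simp only [mul_zero, zero_sub]
      rw [Real.zero_rpow (by positivity)]
      nlinarith
    · nlinarith)
  refine ⟨δ, δ ^ (1 + α) / α, hρ0, hρ1, hα0, hα1, hδ.1, hδ.2, by field_simp, ?_⟩
  dsimp only at h
  field_simp
  linarith

namespace StationaryLoan

variable {ρ α δ K : ℝ}

lemma disc_lt_one (h : StationaryLoan ρ α δ K) : δ < 1 := h.disc_lt.trans h.rho_lt_one

lemma value_pos (h : StationaryLoan ρ α δ K) : 0 < K := by
  have := h.mul_value
  have h2 := Real.rpow_pos_of_pos h.disc_pos (1 + α)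
  rw [← this] at h2
  exact pos_of_mul_pos_right h2 h.alpha_pos.le

/-- The stationary Bellman equation: a unit is repaid and the relationship, worth `K`, continues one
period later. With `profit_le_value`, `δ` attains the maximum. -/
lemma value_eq (h : StationaryLoan ρ α δ K) : K = δ ^ α * (ρ * (1 + K) - δ) := by
  have h0 := h.alpha_pos
  have := profit_eq (α := α) (e := δ) (A := ρ * (1 + K)) (B := 1) h0 h.disc_pos.le
    (by rw [h.firstOrder]; ring)
  rw [mul_one, one_mul] at this
  rw [this, ← h.mul_value]
  field_simp

lemma profit_le_value (h : StationaryLoan ρ α δ K) {d : ℝ} (hd : 0 ≤ d) :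
    d ^ α * (ρ * (1 + K) - d) ≤ K := by
  have h0 := h.alpha_pos
  have := profit_le (α := α) (d := d) (e := δ) (A := ρ * (1 + K)) (B := 1) h0 hd h.disc_pos.le
    zero_le_one (by rw [h.firstOrder]; ring)
  rw [mul_one, one_mul, ← h.mul_value] at this
  rwa [mul_div_cancel_left₀ _ h0.ne'] at this

/-- The key estimate that makes a direct jump to the best repayment amount optimal among the
repayment amounts at which the continuation value is not too large. -/
lemma rpow_add_value_le (h : StationaryLoan ρ α δ K) {s : ℝ} (hs : δ ≤ s) (hs1 : s ≤ 1) :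
    s ^ (1 + α) + K ≤ s ^ α * (1 + K) := by
  have h0 := h.alpha_pos
  have hs0 : 0 < s := h.disc_pos.trans_le hs
  have hr : s ^ (1 + α) = s * s ^ α := Real.rpow_one_add' hs0.le (by positivity)
  -- The claim is `K * (1 - s ^ α) ≤ s ^ α * (1 - s)`. Bounding `K` by `s ^ (1 + α) / α` reduces it
  -- to the tangent inequality `(1 + α) * s ≤ α + s ^ (1 + α)`.
  have h1 : α * K ≤ s ^ (1 + α) := by
    rw [h.mul_value]
    exact Real.rpow_le_rpow h.disc_pos.le hs (by positivity)
  have h2 := young_rpow_le h0 (zero_le_one) hs0.le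
  rw [Real.one_rpow, Real.one_rpow] at h2
  have h3 : s ^ α ≤ 1 := Real.rpow_le_one hs0.le hs1 h0.le
  have h4 := mul_le_mul_of_nonneg_right h1 (sub_nonneg.2 h3)
  have h5 : 0 < s ^ α := Real.rpow_pos_of_pos hs0 _
  have h6 : s ^ α * (s - s * s ^ α) ≤ s ^ α * (α * (1 - s)) :=
    mul_le_mul_of_nonneg_left (by rw [hr] at h2; linarith) h5.le
  have : α * (s ^ (1 + α) + K) ≤ α * (s ^ α * (1 + K)) := by
    rw [hr] at h4 ⊢
    nlinarith
  exact le_of_mul_le_mul_left this h0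

end StationaryLoan

end

section

/-! ### Policies and the Bellman equation for a continuous survival function -/

/-- A continuous survival function of an income with values in `(0, 1)`. -/
structure IsSurvival (G : ℝ → ℝ) : Prop where
  continuous : Continuous G
  antitone : Antitone G
  zero : G 0 = 1
  nonneg : ∀ y, 0 ≤ G y
  le_one : ∀ y, G y ≤ 1
  eq_zero : ∀ y, 1 ≤ y → G y = 0

/-- The largest repayment amount before period `t`, starting from the record `m`. -/
def record (m : ℝ) (y : ℕ → ℝ) : ℕ → ℝ
  | 0 => m
  | t + 1 => max (record m y t) (y t)

lemma record_succ' (m : ℝ) (y : ℕ → ℝ) (t : ℕ) :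
    record m y (t + 1) = record (max m (y 0)) (fun i => y (i + 1)) t := by
  induction t with
  | zero => rfl
  | succ t ih => rw [record, ih]; rfl

/-- Pairs of a repayment amount and a discount rate, in each period, with bounded repayment
amounts. -/
def admissible (ρ : ℝ) : Set (ℕ → ℝ × ℝ) :=
  Set.univ.pi fun _ => Set.Icc 0 1 ×ˢ Set.Icc 0 ρ

/-- The expected discounted cash flow of period `t` when the consumer is known to have repaid `m`,
weighted with the probability of that event. -/
noncomputable def flow (ρ α : ℝ) (G : ℝ → ℝ) (m : ℝ) (q : ℕ → ℝ × ℝ) (t : ℕ) : ℝ :=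
  ρ ^ t * (∏ i ∈ Finset.range (t + 1), (q i).2 ^ α) *
    ((q t).1 * (ρ * G (record m (fun i => (q i).1) (t + 1))
      - (q t).2 * G (record m (fun i => (q i).1) t)))

/-- The value of a policy from the record `m` on. -/
noncomputable def npv (ρ α : ℝ) (G : ℝ → ℝ) (m : ℝ) (q : ℕ → ℝ × ℝ) : ℝ :=
  ∑' t, flow ρ α G m q t

/-- The best value of a policy from the record `m` on. -/
noncomputable def optValue (ρ α : ℝ) (G : ℝ → ℝ) (m : ℝ) : ℝ :=
  sSup (npv ρ α G m '' admissible ρ)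

/-- The value of offering the repayment amount `y` at the discount rate `d` when the continuation
value is `W`. -/
noncomputable def bellman (ρ α : ℝ) (G W : ℝ → ℝ) (m y d : ℝ) : ℝ :=
  d ^ α * (y * (ρ * G (max m y) - d * G m) + ρ * W (max m y))

variable {ρ α : ℝ} {G : ℝ → ℝ}

lemma flow_zero (m : ℝ) (q : ℕ → ℝ × ℝ) :
    flow ρ α G m q 0
      = (q 0).2 ^ α * ((q 0).1 * (ρ * G (max m (q 0).1) - (q 0).2 * G m)) := by
  simp [flow, record]

lemma flow_succ (m : ℝ) (q : ℕ → ℝ × ℝ) (t : ℕ) :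
    flow ρ α G m q (t + 1)
      = (q 0).2 ^ α * ρ * flow ρ α G (max m (q 0).1) (fun i => q (i + 1)) t := by
  simp only [flow]
  rw [record_succ' m _ (t + 1), record_succ' m _ t, Finset.prod_range_succ']
  ring

lemma admissible_tail {q : ℕ → ℝ × ℝ} (hq : q ∈ admissible ρ) :
    (fun i => q (i + 1)) ∈ admissible ρ :=
  fun i _ => hq (i + 1) trivial

lemma abs_flow_le (hρ0 : 0 < ρ) (hρ1 : ρ < 1) (hα : 0 < α) (hG : IsSurvival G) (m : ℝ)
    {q : ℕ → ℝ × ℝ} (hq : q ∈ admissible ρ) (t : ℕ) : |flow ρ α G m q t| ≤ ρ ^ t := by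
  have hq' : ∀ i, (0 ≤ (q i).1 ∧ (q i).1 ≤ 1) ∧ (0 ≤ (q i).2 ∧ (q i).2 ≤ ρ) :=
    fun i => hq i trivial
  rw [flow, abs_mul, abs_mul, abs_of_nonneg (pow_nonneg hρ0.le t)]
  have h1 : |∏ i ∈ Finset.range (t + 1), (q i).2 ^ α| ≤ 1 := by
    rw [abs_of_nonneg (Finset.prod_nonneg fun i _ => Real.rpow_nonneg (hq' i).2.1 _)]
    exact Finset.prod_le_one (fun i _ => Real.rpow_nonneg (hq' i).2.1 _)
      fun i _ => Real.rpow_le_one (hq' i).2.1 ((hq' i).2.2.trans hρ1.le) hα.le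
  have h2 : |(q t).1 * (ρ * G (record m (fun i => (q i).1) (t + 1))
      - (q t).2 * G (record m (fun i => (q i).1) t))| ≤ 1 := by
    rw [abs_mul, abs_of_nonneg (hq' t).1.1]
    refine mul_le_one₀ (hq' t).1.2 (abs_nonneg _) ?_
    have a1 := hG.nonneg (record m (fun i => (q i).1) (t + 1))
    have a2 := hG.nonneg (record m (fun i => (q i).1) t)
    have b1 := hG.le_one (record m (fun i => (q i).1) (t + 1))
    have b2 := hG.le_one (record m (fun i => (q i).1) t)
    have c1 := mul_le_one₀ hρ1.le a1 b1
    have c2 := mul_le_one₀ ((hq' t).2.2.trans hρ1.le) a2 b2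
    have c3 := mul_nonneg hρ0.le a1
    have c4 := mul_nonneg (hq' t).2.1 a2
    rw [abs_le]
    constructor <;> linarith
  calc ρ ^ t * _ * _ ≤ ρ ^ t * 1 * 1 := by gcongr
    _ = ρ ^ t := by ring

lemma summable_flow (hρ0 : 0 < ρ) (hρ1 : ρ < 1) (hα : 0 < α) (hG : IsSurvival G) (m : ℝ)
    {q : ℕ → ℝ × ℝ} (hq : q ∈ admissible ρ) : Summable (flow ρ α G m q) :=
  Summable.of_norm_bounded (summable_geometric_of_lt_one hρ0.le hρ1)
    fun t => abs_flow_le hρ0 hρ1 hα hG m hq t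

/-- The tail of a policy is a policy started from the updated record, because the flows carry the
survival probability itself rather than conditional probabilities. -/
lemma npv_eq_bellman (hρ0 : 0 < ρ) (hρ1 : ρ < 1) (hα : 0 < α) (hG : IsSurvival G) (m : ℝ)
    {q : ℕ → ℝ × ℝ} (hq : q ∈ admissible ρ) :
    npv ρ α G m q
      = (q 0).2 ^ α * ((q 0).1 * (ρ * G (max m (q 0).1) - (q 0).2 * G m)
        + ρ * npv ρ α G (max m (q 0).1) (fun i => q (i + 1))) := by
  rw [npv, (summable_flow hρ0 hρ1 hα hG m hq).tsum_eq_zero_add, flow_zero]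
  simp only [flow_succ]
  rw [tsum_mul_left, npv]
  ring

lemma isCompact_admissible (ρ : ℝ) : IsCompact (admissible ρ) :=
  isCompact_univ_pi fun _ => isCompact_Icc.prod isCompact_Icc

lemma admissible_nonempty (hρ0 : 0 < ρ) : (admissible ρ).Nonempty :=
  ⟨fun _ => (0, 0), fun _ _ => ⟨⟨le_rfl, zero_le_one⟩, ⟨le_rfl, hρ0.le⟩⟩⟩

lemma continuous_record (m : ℝ) (t : ℕ) :
    Continuous fun q : ℕ → ℝ × ℝ => record m (fun i => (q i).1) t := by
  induction t with
  | zero => exact continuous_const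
  | succ t ih =>
    simp only [record]
    exact ih.max (by fun_prop)

lemma continuous_flow (hα : 0 < α) (hG : IsSurvival G) (m : ℝ) (t : ℕ) :
    Continuous fun q => flow ρ α G m q t := by
  have h1 : ∀ i, Continuous fun q : ℕ → ℝ × ℝ => (q i).2 ^ α := fun i =>
    (Real.continuous_rpow_const hα.le).comp (by fun_prop)
  have h2 := fun t => hG.continuous.comp (continuous_record m t)
  have h3 : Continuous fun q : ℕ → ℝ × ℝ => ∏ i ∈ Finset.range (t + 1), (q i).2 ^ α :=
    continuous_finsetProd _ fun i _ => h1 i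
  have h4 := h2 t
  have h5 := h2 (t + 1)
  simp only [Function.comp_def] at h4 h5
  have h6 : Continuous fun q : ℕ → ℝ × ℝ => (q t).1 := by fun_prop
  have h7 : Continuous fun q : ℕ → ℝ × ℝ => (q t).2 := by fun_prop
  exact (continuous_const.mul h3).mul (h6.mul ((continuous_const.mul h5).sub (h7.mul h4)))

lemma continuousOn_npv (hρ0 : 0 < ρ) (hρ1 : ρ < 1) (hα : 0 < α) (hG : IsSurvival G) (m : ℝ) :
    ContinuousOn (npv ρ α G m) (admissible ρ) :=
  continuousOn_tsum (fun t => (continuous_flow hα hG m t).continuousOn)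
    (summable_geometric_of_lt_one hρ0.le hρ1) fun t _ hq => abs_flow_le hρ0 hρ1 hα hG m hq t

/-- Policies form a compact product and, by the geometric bound on the flows, the value is a uniform
limit of continuous functions. -/
lemma exists_npv_eq_optValue (hρ0 : 0 < ρ) (hρ1 : ρ < 1) (hα : 0 < α) (hG : IsSurvival G)
    (m : ℝ) : ∃ q ∈ admissible ρ, npv ρ α G m q = optValue ρ α G m :=
  ((isCompact_admissible ρ).image_of_continuousOn (continuousOn_npv hρ0 hρ1 hα hG m)).sSup_mem
    ((admissible_nonempty hρ0).image _)

lemma npv_le_optValue (hρ0 : 0 < ρ) (hρ1 : ρ < 1) (hα : 0 < α) (hG : IsSurvival G)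
    (m : ℝ) {q : ℕ → ℝ × ℝ} (hq : q ∈ admissible ρ) : npv ρ α G m q ≤ optValue ρ α G m :=
  le_csSup ((isCompact_admissible ρ).image_of_continuousOn
    (continuousOn_npv hρ0 hρ1 hα hG m)).bddAbove (Set.mem_image_of_mem _ hq)

lemma bellman_le_optValue (hρ0 : 0 < ρ) (hρ1 : ρ < 1) (hα : 0 < α) (hG : IsSurvival G)
    (m : ℝ) {y d : ℝ} (hy : y ∈ Set.Icc (0 : ℝ) 1) (hd : d ∈ Set.Icc 0 ρ) :
    bellman ρ α G (optValue ρ α G) m y d ≤ optValue ρ α G m := by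
  obtain ⟨q, hq, h⟩ := exists_npv_eq_optValue hρ0 hρ1 hα hG (max m y)
  let q' : ℕ → ℝ × ℝ := fun t => Nat.casesOn t (y, d) q
  have hq' : q' ∈ admissible ρ := by
    intro i _
    cases i with
    | zero => exact ⟨hy, hd⟩
    | succ i => exact hq i trivial
  have := npv_le_optValue hρ0 hρ1 hα hG m hq'
  rw [npv_eq_bellman hρ0 hρ1 hα hG m hq'] at this
  rw [bellman, ← h]
  exact this

/-- The first step of an optimal policy from the record `m` on. -/
structure IsOptStep (ρ α : ℝ) (G : ℝ → ℝ) (m y d : ℝ) : Prop where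
  repay_mem : y ∈ Set.Icc (0 : ℝ) 1
  disc_mem : d ∈ Set.Icc 0 ρ
  eq : optValue ρ α G m = bellman ρ α G (optValue ρ α G) m y d

lemma exists_isOptStep (hρ0 : 0 < ρ) (hρ1 : ρ < 1) (hα : 0 < α) (hG : IsSurvival G)
    (m : ℝ) : ∃ y d, IsOptStep ρ α G m y d := by
  obtain ⟨q, hq, h⟩ := exists_npv_eq_optValue hρ0 hρ1 hα hG m
  have h0 := hq 0 trivial
  refine ⟨(q 0).1, (q 0).2, h0.1, h0.2, le_antisymm ?_
    (bellman_le_optValue hρ0 hρ1 hα hG m h0.1 h0.2)⟩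
  rw [← h, npv_eq_bellman hρ0 hρ1 hα hG m hq, bellman]
  have h1 := npv_le_optValue hρ0 hρ1 hα hG (max m (q 0).1) (admissible_tail hq)
  have := Real.rpow_nonneg h0.2.1 α
  gcongr

/-- Records never decrease, so the supersolution property is needed only above `m₀`. Nonnegativity
of `W` covers the empty sum at which the induction starts. -/
lemma sum_flow_le {W : ℝ → ℝ} {m₀ : ℝ} (hW : ∀ m, m₀ ≤ m → 0 ≤ W m)
    (hρ0 : 0 < ρ) (h : ∀ m, m₀ ≤ m → ∀ y ∈ Set.Icc (0 : ℝ) 1, ∀ d ∈ Set.Icc 0 ρ,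
      bellman ρ α G W m y d ≤ W m) (n : ℕ) :
    ∀ m, m₀ ≤ m → ∀ q ∈ admissible ρ, ∑ t ∈ Finset.range n, flow ρ α G m q t ≤ W m := by
  induction n with
  | zero => intro m hm q _; simpa using hW m hm
  | succ n ih =>
    intro m hm q hq
    have h0 := hq 0 trivial
    rw [Finset.sum_range_succ', flow_zero]
    simp only [flow_succ]
    rw [← Finset.mul_sum]
    have h1 := ih (max m (q 0).1) (le_max_of_le_left hm) _ (admissible_tail hq)
    have h2 := h m hm _ h0.1 _ h0.2
    rw [bellman] at h2
    have h3 := Real.rpow_nonneg h0.2.1 α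
    have h4 := mul_le_mul_of_nonneg_left h1 (mul_nonneg h3 hρ0.le)
    linarith

/-- Verification: a nonnegative supersolution of the Bellman equation bounds the value. -/
lemma optValue_le_of_bellman_le {W : ℝ → ℝ} {m₀ : ℝ} (hρ0 : 0 < ρ) (hρ1 : ρ < 1) (hα : 0 < α)
    (hG : IsSurvival G) (hW : ∀ m, m₀ ≤ m → 0 ≤ W m)
    (h : ∀ m, m₀ ≤ m → ∀ y ∈ Set.Icc (0 : ℝ) 1, ∀ d ∈ Set.Icc 0 ρ,
      bellman ρ α G W m y d ≤ W m) {m : ℝ} (hm : m₀ ≤ m) : optValue ρ α G m ≤ W m := by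
  obtain ⟨q, hq, hqm⟩ := exists_npv_eq_optValue hρ0 hρ1 hα hG m
  rw [← hqm]
  exact le_of_tendsto' (summable_flow hρ0 hρ1 hα hG m hq).hasSum.tendsto_sum_nat
    fun n => sum_flow_le hW hρ0 h n m hm q hq

end

section

/-! ### The structure of optimal policies -/

/-- A survival function `G` for which `y * G y ^ (1 + α)` is unimodal with mode `z`. -/
structure HasPeak (α : ℝ) (G : ℝ → ℝ) (z : ℝ) : Prop extends IsSurvival G where
  strictAnti : StrictAntiOn G (Set.Icc 0 1)
  peak_mem : z ∈ Set.Ioo (0 : ℝ) 1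
  mono : StrictMonoOn (fun y => y * G y ^ (1 + α)) (Set.Icc 0 z)
  anti : StrictAntiOn (fun y => y * G y ^ (1 + α)) (Set.Icc z 1)

variable {ρ α δ K : ℝ} {G : ℝ → ℝ} {z : ℝ}

lemma HasPeak.pos (h : HasPeak α G z) {y : ℝ} (hy : y < 1) : 0 < G y := by
  rcases le_total y 0 with h0 | h0
  · have := h.antitone h0
    rw [h.zero] at this
    linarith
  · have := h.strictAnti (Set.mem_Icc.2 ⟨h0, hy.le⟩) (Set.right_mem_Icc.2 zero_le_one) hy
    rwa [h.eq_zero 1 le_rfl] at this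

lemma HasPeak.le_peak (h : HasPeak α G z) {y : ℝ} (hy : y ∈ Set.Icc (0 : ℝ) 1) :
    y * G y ^ (1 + α) ≤ z * G z ^ (1 + α) := by
  have hz := h.peak_mem
  rcases le_total y z with hyz | hyz
  · exact h.mono.monotoneOn ⟨hy.1, hyz⟩ ⟨hz.1.le, le_rfl⟩ hyz
  · exact h.anti.antitoneOn ⟨le_rfl, hz.2.le⟩ ⟨hyz, hy.2⟩ hyz

lemma HasPeak.peak_pos (h : HasPeak α G z) : 0 < z * G z ^ (1 + α) :=
  mul_pos h.peak_mem.1 (Real.rpow_pos_of_pos (h.pos h.peak_mem.2) _)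

namespace StationaryLoan

/-- Repeating `y` at rate `δ` leaves the record unchanged, so the Bellman inequality is a linear
inequality for the value, solved using `1 - ρ * δ ^ α > 0`. -/
lemma mul_le_optValue (hS : StationaryLoan ρ α δ K) (hG : IsSurvival G) {y : ℝ}
    (hy : y ∈ Set.Icc (0 : ℝ) 1) : K * (y * G y) ≤ optValue ρ α G y := by
  have h := bellman_le_optValue hS.rho_pos hS.rho_lt_one hS.alpha_pos hG y hy
    ⟨hS.disc_pos.le, hS.disc_lt.le⟩
  rw [bellman, max_self] at h
  have h1 : δ ^ α < 1 := Real.rpow_lt_one hS.disc_pos.le hS.disc_lt_one hS.alpha_pos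
  have h2 : 0 < 1 - ρ * δ ^ α := by nlinarith [hS.rho_lt_one, hS.rho_pos]
  have h3 := hS.value_eq
  have h4 : K * (y * G y) * (1 - ρ * δ ^ α) ≤ optValue ρ α G y * (1 - ρ * δ ^ α) := by
    have : K * (1 - ρ * δ ^ α) = δ ^ α * (ρ - δ) := by linear_combination h3
    calc K * (y * G y) * (1 - ρ * δ ^ α) = δ ^ α * (ρ - δ) * (y * G y) := by rw [← this]; ring
      _ ≤ _ := by linarith
  exact le_of_mul_le_mul_right h4 h2

/-- The rate `δ * (G y / G m)` is the maximizer in `profit_eq` when the continuation value is the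
stationary one, `K * (y * G y)`. The resulting value depends on `y` only through `y * G y ^ (1 +
α)`. -/
lemma static_le_bellman (hS : StationaryLoan ρ α δ K) (hG : IsSurvival G) {m y : ℝ}
    (hm : 0 ≤ m) (hmy : m ≤ y) (hy : y ≤ 1) (hGm : 0 < G m) :
    K * G m ^ (-α) * (y * G y ^ (1 + α))
      ≤ bellman ρ α G (optValue ρ α G) m y (δ * (G y / G m)) := by
  have hα := hS.alpha_pos
  have hK := hS.value_pos
  have hGy := hG.nonneg y
  have he : 0 ≤ δ * (G y / G m) := mul_nonneg hS.disc_pos.le (div_nonneg hGy hGm.le)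
  have h1 := hS.mul_le_optValue hG (y := y) ⟨hm.trans hmy, hy⟩
  have h2 := profit_eq (α := α) (e := δ * (G y / G m)) (A := ρ * (1 + K) * (y * G y))
    (B := y * G m) hα he (by
      have := hS.firstOrder
      field_simp
      linear_combination (y * G y) * this)
  have h3 : y * G m * (δ * (G y / G m)) ^ (1 + α) / α
      = K * G m ^ (-α) * (y * G y ^ (1 + α)) := by
    rw [Real.mul_rpow hS.disc_pos.le (by positivity), Real.div_rpow hGy hGm.le, ← hS.mul_value,
      Real.rpow_neg hGm.le, Real.rpow_one_add' hGm.le (by positivity)]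
    have := Real.rpow_pos_of_pos hGm α
    field_simp
  rw [← h3, ← h2, bellman, max_eq_right hmy]
  refine mul_le_mul_of_nonneg_left ?_ (Real.rpow_nonneg he _)
  have := mul_le_mul_of_nonneg_left h1 hS.rho_pos.le
  linarith

lemma static_disc_mem (hS : StationaryLoan ρ α δ K) (hG : IsSurvival G) {m y : ℝ}
    (hmy : m ≤ y) (hGm : 0 < G m) : δ * (G y / G m) ∈ Set.Icc 0 ρ := by
  have h1 : 0 ≤ G y / G m := div_nonneg (hG.nonneg y) hGm.le
  have h2 : G y / G m ≤ 1 := (div_le_one hGm).2 (hG.antitone hmy)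
  exact ⟨mul_nonneg hS.disc_pos.le h1, by nlinarith [hS.disc_lt, hS.disc_pos]⟩

lemma static_le_optValue (hS : StationaryLoan ρ α δ K) (hG : IsSurvival G) {m y : ℝ}
    (hm : 0 ≤ m) (hmy : m ≤ y) (hy : y ≤ 1) (hGm : 0 < G m) :
    K * G m ^ (-α) * (y * G y ^ (1 + α)) ≤ optValue ρ α G m :=
  (hS.static_le_bellman hG hm hmy hy hGm).trans
    (bellman_le_optValue hS.rho_pos hS.rho_lt_one hS.alpha_pos hG m ⟨hm.trans hmy, hy⟩
      (hS.static_disc_mem hG hmy hGm))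

/-- If the continuation value is at most that of a jump to a repayment amount with
`y * G y ^ (1 + α) = H`, then so is the value of offering a repayment amount that is not too
bad compared to `H`. -/
lemma step_le_static (hS : StationaryLoan ρ α δ K) {y d w g M H : ℝ} (hy : 0 < y)
    (hg : 0 < g) (hM : 0 < M) (hd : 0 ≤ d) (hw : w ≤ K * g ^ (-α) * H)
    (hlow : δ ^ (1 + α) * H ≤ y * g ^ (1 + α)) (hup : y * g ^ (1 + α) ≤ H) :
    d ^ α * (y * (ρ * g - d * M) + ρ * w) ≤ K * M ^ (-α) * H := by
  have hα := hS.alpha_pos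
  have hK := hS.value_pos
  have h1α : 0 < 1 + α := by positivity
  have hx : 0 < y * g ^ (1 + α) := mul_pos hy (Real.rpow_pos_of_pos hg _)
  have hH : 0 < H := hx.trans_le hup
  -- The factor `s` measures how far `y` falls short of `H`; the bounds `hlow` and `hup` become `δ ≤
  -- s ≤ 1`, the range of `rpow_add_value_le`.
  obtain ⟨s, hs0, hs⟩ : ∃ s : ℝ, 0 < s ∧ H * s ^ (1 + α) = y * g ^ (1 + α) := by
    refine ⟨(y * g ^ (1 + α) / H) ^ (1 + α)⁻¹, Real.rpow_pos_of_pos (by positivity) _, ?_⟩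
    rw [Real.rpow_inv_rpow (by positivity) h1α.ne']
    field_simp
  have hδs : δ ≤ s := by
    rw [← hs, mul_comm H] at hlow
    exact (Real.rpow_le_rpow_iff hS.disc_pos.le hs0.le h1α).1 (le_of_mul_le_mul_right hlow hH)
  have hs1 : s ≤ 1 := by
    rw [← hs] at hup
    have : s ^ (1 + α) ≤ 1 := by
      by_contra! hc
      nlinarith
    exact (Real.rpow_le_rpow_iff hs0.le zero_le_one h1α).1 (by rwa [Real.one_rpow])
  have hkey := hS.rpow_add_value_le hδs hs1
  have hsα := Real.rpow_pos_of_pos hs0 α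
  have hgα := Real.rpow_pos_of_pos hg α
  have hMα := Real.rpow_pos_of_pos hM α
  rw [Real.rpow_one_add' hs0.le h1α.ne'] at hkey hs
  rw [Real.rpow_one_add' hg.le h1α.ne'] at hs
  have hH' : H = y * (g * g ^ α) / (s * s ^ α) := by
    rw [eq_div_iff (by positivity)]
    exact hs
  have hA : y * g + w ≤ (1 + K) * (y * g / s) := by
    have : y * g + K * g ^ (-α) * H = (y * g / (s * s ^ α)) * (s * s ^ α + K) := by
      rw [hH', Real.rpow_neg hg.le]
      field_simp
    calc y * g + w ≤ y * g + K * g ^ (-α) * H := by linarith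
      _ = (y * g / (s * s ^ α)) * (s * s ^ α + K) := this
      _ ≤ (y * g / (s * s ^ α)) * (s ^ α * (1 + K)) :=
          mul_le_mul_of_nonneg_left hkey (by positivity)
      _ = _ := by field_simp
  -- After the estimate `hA`, the step is no better than a stationary one with survival `g / s` in
  -- place of `g`, whose optimal value is exactly the claimed bound.
  have h2 := profit_le (α := α) (d := d) (e := δ * (g / (s * M)))
    (A := ρ * ((1 + K) * (y * g / s))) (B := y * M) hα hd
    (mul_nonneg hS.disc_pos.le (by positivity)) (by positivity) (by
      have := hS.firstOrder
      field_simp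
      linear_combination this)
  have h3 : y * M * (δ * (g / (s * M))) ^ (1 + α) / α = K * M ^ (-α) * H := by
    rw [Real.mul_rpow hS.disc_pos.le (by positivity), ← hS.mul_value,
      Real.rpow_neg hM.le, Real.rpow_one_add' (by positivity) (by positivity),
      Real.div_rpow hg.le (by positivity), Real.mul_rpow hs0.le hM.le, hH']
    field_simp
  rw [h3] at h2
  refine le_trans (mul_le_mul_of_nonneg_left ?_ (Real.rpow_nonneg hd _)) h2
  have := mul_le_mul_of_nonneg_left hA hS.rho_pos.le
  linarith

end StationaryLoan

end

/-! ### The threshold below which an optimal policy screens -/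

section

variable {ρ α δ K : ℝ} {G : ℝ → ℝ} {z : ℝ}

/-- The repayment amount `m₁` above which an immediate jump to the mode `z` is optimal. -/
structure IsThreshold (α δ : ℝ) (G : ℝ → ℝ) (z m₁ : ℝ) : Prop where
  pos : 0 < m₁
  lt : m₁ < z
  eq : m₁ * G m₁ ^ (1 + α) = δ ^ (1 + α) * (z * G z ^ (1 + α))

lemma HasPeak.continuous_mul_rpow (h : HasPeak α G z) (hα : 0 < α) :
    Continuous fun y => y * G y ^ (1 + α) :=
  continuous_id.mul (h.continuous.rpow_const fun _ => Or.inr (by positivity))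

lemma exists_isThreshold (hS : StationaryLoan ρ α δ K) (h : HasPeak α G z) :
    ∃ m₁, IsThreshold α δ G z m₁ := by
  have hα := hS.alpha_pos
  have h1 := intermediate_value_Ioo h.peak_mem.1.le (h.continuous_mul_rpow hα).continuousOn
  have h2 : δ ^ (1 + α) < 1 := Real.rpow_lt_one hS.disc_pos.le hS.disc_lt_one (by positivity)
  have h3 : 0 < δ ^ (1 + α) := Real.rpow_pos_of_pos hS.disc_pos _
  have h4 := h.peak_pos
  obtain ⟨m, hm, he⟩ := h1 (show δ ^ (1 + α) * (z * G z ^ (1 + α)) ∈ _ by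
    constructor
    · rw [zero_mul]
      positivity
    · nlinarith)
  exact ⟨m, hm.1, hm.2, he⟩

lemma HasPeak.le_max (h : HasPeak α G z) {m y : ℝ} (hmy : m ≤ y) (hy : y ≤ 1) :
    max y z * G (max y z) ^ (1 + α) ≤ max m z * G (max m z) ^ (1 + α) :=
  h.anti.antitoneOn ⟨le_max_right _ _, max_le (hmy.trans hy) h.peak_mem.2.le⟩
    ⟨le_max_right _ _, max_le hy h.peak_mem.2.le⟩ (max_le_max_right z hmy)

namespace StationaryLoan

lemma step_le_of_threshold_le (hS : StationaryLoan ρ α δ K) (h : HasPeak α G z) {m₁ : ℝ}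
    (hm₁ : IsThreshold α δ G z m₁) {m y d w : ℝ} (hm : m < 1) (hy : m₁ ≤ y) (hy1 : y ≤ 1)
    (hd : 0 ≤ d) (hw : w ≤ K * G y ^ (-α) * (max y z * G (max y z) ^ (1 + α))) :
    d ^ α * (y * (ρ * G y - d * G m) + ρ * w)
      ≤ K * G m ^ (-α) * (max y z * G (max y z) ^ (1 + α)) := by
  have hα := hS.alpha_pos
  have hy0 : 0 < y := hm₁.pos.trans_le hy
  rcases hy1.eq_or_lt with rfl | hy1
  · have e1 : (0 : ℝ) ^ (1 + α) = 0 := Real.zero_rpow (by positivity)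
    rw [max_eq_left h.peak_mem.2.le, h.eq_zero 1 le_rfl, e1] at hw ⊢
    simp only [mul_zero, one_mul] at hw ⊢
    have h1 := mul_nonneg hd (h.nonneg m)
    refine mul_nonpos_of_nonneg_of_nonpos (Real.rpow_nonneg hd _) ?_
    have := mul_nonpos_of_nonneg_of_nonpos hS.rho_pos.le hw
    linarith
  · refine hS.step_le_static hy0 (h.pos hy1) (h.pos hm) hd hw ?_ ?_
    · rcases le_total y z with hyz | hyz
      · rw [max_eq_right hyz, ← hm₁.eq]
        exact h.mono.monotoneOn ⟨hm₁.pos.le, hm₁.lt.le⟩ ⟨hy0.le, hyz⟩ hy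
      · rw [max_eq_left hyz]
        have : δ ^ (1 + α) ≤ 1 :=
          Real.rpow_le_one hS.disc_pos.le hS.disc_lt_one.le (by positivity)
        have h2 : 0 ≤ y * G y ^ (1 + α) := mul_nonneg hy0.le (Real.rpow_nonneg (h.nonneg y) _)
        nlinarith
    · rcases le_total y z with hyz | hyz
      · rw [max_eq_right hyz]
        exact h.le_peak ⟨hy0.le, hy1.le⟩
      · rw [max_eq_left hyz]

/-- The right-hand side, the value of an immediate jump to `max m z`, is a supersolution of the
Bellman equation on records at least `m₁`, so verification applies. -/
lemma optValue_le_of_threshold_le (hS : StationaryLoan ρ α δ K) (h : HasPeak α G z) {m₁ : ℝ}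
    (hm₁ : IsThreshold α δ G z m₁) {m : ℝ} (hm : m₁ ≤ m) :
    optValue ρ α G m ≤ K * G m ^ (-α) * (max m z * G (max m z) ^ (1 + α)) := by
  have hα := hS.alpha_pos
  have hK := hS.value_pos
  have hz := h.peak_mem
  have hnn : ∀ m : ℝ, 0 ≤ K * G m ^ (-α) * (max m z * G (max m z) ^ (1 + α)) := fun m =>
    mul_nonneg (mul_nonneg hK.le (Real.rpow_nonneg (h.nonneg m) _))
      (mul_nonneg (hz.1.le.trans (le_max_right _ _)) (Real.rpow_nonneg (h.nonneg _) _))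
  refine optValue_le_of_bellman_le (m₀ := m₁)
    (W := fun m => K * G m ^ (-α) * (max m z * G (max m z) ^ (1 + α)))
    hS.rho_pos hS.rho_lt_one hα h.toIsSurvival (fun m _ => hnn m) ?_ hm
  intro m hm y hy d hd
  rw [bellman]
  rcases le_or_gt 1 m with hm1 | hm1
  · have h1 : G m = 0 := h.eq_zero m hm1
    have h2 : G (max m y) = 0 := h.eq_zero _ (hm1.trans (le_max_left _ _))
    rw [h1, h2, Real.zero_rpow (neg_ne_zero.2 hα.ne')]
    simp
  · rcases le_total y m with hym | hym
    -- An offer below the record reveals nothing and, since `d ≤ ρ`, earns no more than offering the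
    -- record itself.
    · rw [max_eq_left hym]
      refine le_trans (mul_le_mul_of_nonneg_left ?_ (Real.rpow_nonneg hd.1 _))
        (hS.step_le_of_threshold_le h hm₁ hm1 hm hm1.le hd.1 le_rfl)
      have := mul_le_mul_of_nonneg_right hym
        (mul_nonneg (sub_nonneg.2 hd.2) (h.nonneg m))
      linarith
    · rw [max_eq_right hym]
      refine (hS.step_le_of_threshold_le h hm₁ hm1 (hm.trans hym) hy.2 hd.1 le_rfl).trans ?_
      exact mul_le_mul_of_nonneg_left (h.le_max hym hy.2)
        (mul_nonneg hK.le (Real.rpow_nonneg (h.nonneg m) _))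

lemma optValue_pos (hS : StationaryLoan ρ α δ K) (h : HasPeak α G z) {m : ℝ} (hm0 : 0 ≤ m)
    (hm : m < 1) : 0 < optValue ρ α G m := by
  have hMy : m < (m + 1) / 2 := by linarith
  have hy : (m + 1) / 2 < 1 := by linarith
  have hM := h.pos hm
  refine lt_of_lt_of_le ?_ (hS.static_le_optValue h.toIsSurvival hm0 hMy.le hy.le hM)
  have := Real.rpow_pos_of_pos (h.pos hy) (1 + α)
  have := Real.rpow_pos_of_pos hM (-α)
  have := hS.value_pos
  positivity

/-- Below the threshold, the continuation value is large. -/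
lemma mul_lt_optValue (hS : StationaryLoan ρ α δ K) (h : HasPeak α G z) {m₁ : ℝ}
    (hm₁ : IsThreshold α δ G z m₁) {m : ℝ} (hm0 : 0 ≤ m) (hm : m < m₁) :
    m * G m < α * optValue ρ α G m := by
  have hα := hS.alpha_pos
  have hz := h.peak_mem
  have hmz : m < z := hm.trans hm₁.lt
  have hM := h.pos (hmz.trans hz.2)
  have h1 := hS.static_le_optValue h.toIsSurvival hm0 hmz.le hz.2.le hM
  have h2 : m * G m ^ (1 + α) < m₁ * G m₁ ^ (1 + α) :=
    h.mono ⟨hm0, hmz.le⟩ ⟨hm₁.pos.le, hm₁.lt.le⟩ hm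
  rw [hm₁.eq, ← hS.mul_value, Real.rpow_one_add' hM.le (by positivity)] at h2
  have h3 := Real.rpow_pos_of_pos hM α
  rw [Real.rpow_neg hM.le] at h1
  calc m * G m = m * (G m * G m ^ α) * (G m ^ α)⁻¹ := by field_simp
    _ < α * K * (z * G z ^ (1 + α)) * (G m ^ α)⁻¹ :=
        mul_lt_mul_of_pos_right h2 (by positivity)
    _ = α * (K * (G m ^ α)⁻¹ * (z * G z ^ (1 + α))) := by ring
    _ ≤ _ := mul_le_mul_of_nonneg_left h1 hα.le

lemma isOptStep_disc_pos (hS : StationaryLoan ρ α δ K) (h : HasPeak α G z) {m y d : ℝ}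
    (hm0 : 0 ≤ m) (hm : m < 1) (ho : IsOptStep ρ α G m y d) : 0 < d := by
  refine lt_of_le_of_ne ho.disc_mem.1 ?_
  rintro rfl
  have := hS.optValue_pos h hm0 hm
  rw [ho.eq, bellman, Real.zero_rpow hS.alpha_pos.ne', zero_mul] at this
  exact lt_irrefl _ this

/-- Below the threshold, an optimal policy offers a new record repayment amount. -/
lemma isOptStep_lt (hS : StationaryLoan ρ α δ K) (h : HasPeak α G z) {m₁ : ℝ}
    (hm₁ : IsThreshold α δ G z m₁) {m y d : ℝ} (hm0 : 0 ≤ m) (hm : m < m₁)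
    (ho : IsOptStep ρ α G m y d) : m < y := by
  by_contra! hym
  have hα := hS.alpha_pos
  have hm1 : m < 1 := hm.trans (hm₁.lt.trans h.peak_mem.2)
  have hW := hS.optValue_pos h hm0 hm1
  have h1 := hS.mul_lt_optValue h hm₁ hm0 hm
  have hd := ho.disc_mem
  have he := ho.eq
  rw [bellman, max_eq_left hym] at he
  set W := optValue ρ α G m
  have hM := h.nonneg m
  have h2 : y * G m ≤ α * W :=
    (mul_le_mul_of_nonneg_right hym hM).trans h1.le
  have h3 := young_rpow_le hα hd.1 hS.rho_pos.le
  have hdd : d ^ (1 + α) = d * d ^ α := Real.rpow_one_add' hd.1 (by positivity)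
  have hρ : ρ ^ (1 + α) < 1 := Real.rpow_lt_one hS.rho_pos.le hS.rho_lt_one (by positivity)
  have hdα := Real.rpow_nonneg hd.1 α
  -- Without a new record the state does not change. By Young's inequality, the factor multiplying
  -- `W` on the right is at most `ρ ^ (1 + α) < 1`, which is absurd for `W > 0`.
  have h4 : W ≤ d ^ α * ((ρ - d) * (α * W) + ρ * W) := by
    have := mul_le_mul_of_nonneg_left h2 (sub_nonneg.2 hd.2)
    calc W = _ := he
      _ ≤ _ := mul_le_mul_of_nonneg_left (by linarith) hdα
  rw [hdd] at h3
  have h5 : d ^ α * ((ρ - d) * (α * W) + ρ * W)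
      = ((1 + α) * d ^ α * ρ - α * (d * d ^ α)) * W := by ring
  rw [h5] at h4
  have h6 : ((1 + α) * d ^ α * ρ - α * (d * d ^ α)) * W < 1 * W :=
    mul_lt_mul_of_pos_right (by linarith) hW
  linarith

/-- At records at least `m₁` the continuation value is bounded by the static one, so an optimal step
that reaches the threshold is worth no more than the direct jump to `z`. -/
lemma isOptStep_peak (hS : StationaryLoan ρ α δ K) (h : HasPeak α G z) {m₁ : ℝ}
    (hm₁ : IsThreshold α δ G z m₁) {m y d : ℝ} (hm0 : 0 ≤ m) (hm : m < m₁) (hy : m₁ ≤ y)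
    (ho : IsOptStep ρ α G m y d) : IsOptStep ρ α G m z (δ * (G z / G m)) := by
  have hα := hS.alpha_pos
  have hz := h.peak_mem
  have hmz : m < z := hm.trans hm₁.lt
  have hm1 : m < 1 := hmz.trans hz.2
  have hM := h.pos hm1
  have hdisc := hS.static_disc_mem h.toIsSurvival hmz.le hM
  have hzm : z ∈ Set.Icc (0 : ℝ) 1 := ⟨hz.1.le, hz.2.le⟩
  refine ⟨hzm, hdisc, le_antisymm ?_
    (bellman_le_optValue hS.rho_pos hS.rho_lt_one hα h.toIsSurvival m hzm hdisc)⟩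
  refine le_trans ?_ (hS.static_le_bellman h.toIsSurvival hm0 hmz.le hz.2.le hM)
  rw [ho.eq, bellman, max_eq_right (hm.le.trans hy)]
  refine (hS.step_le_of_threshold_le h hm₁ hm1 hy ho.repay_mem.2 ho.disc_mem.1
    (hS.optValue_le_of_threshold_le h hm₁ hy)).trans ?_
  have := h.le_max (m := 0) (y := y) ho.repay_mem.1 ho.repay_mem.2
  rw [max_eq_right hz.1.le] at this
  exact mul_le_mul_of_nonneg_left this
    (mul_nonneg hS.value_pos.le (Real.rpow_nonneg hM.le _))

/-- Loans below the threshold are made at an expected loss. -/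
lemma isOptStep_loss (hS : StationaryLoan ρ α δ K) (h : HasPeak α G z) {m₁ : ℝ}
    (hm₁ : IsThreshold α δ G z m₁) {m y d : ℝ} (hm0 : 0 ≤ m) (hmy : m < y) (hy : y < m₁)
    (ho : IsOptStep ρ α G m y d) : ρ * G y < d * G m := by
  by_contra! hc
  have hα := hS.alpha_pos
  have hρ := hS.rho_pos
  have hy0 : 0 < y := hm0.trans_lt hmy
  have hy1 : y < 1 := hy.trans (hm₁.lt.trans h.peak_mem.2)
  have hM := h.pos (hmy.trans hy1)
  have hW := hS.mul_lt_optValue h hm₁ hy0.le hy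
  have hGlt : G y < G m := h.strictAnti ⟨hm0, (hmy.trans hy1).le⟩ ⟨hy0.le, hy1.le⟩ hmy
  have he := ho.eq
  have hB : 0 < y * G m := mul_pos hy0 hM
  set W := optValue ρ α G y with hWdef
  have hE : (1 + α) * d * (y * G m) < α * (ρ * (y * G y + W)) := by
    have h1 : d * G m * y ≤ ρ * G y * y := mul_le_mul_of_nonneg_right hc hy0.le
    have h2 := mul_lt_mul_of_pos_left hW hρ
    nlinarith
  -- If the loan did not lose money, `d` would lie strictly below both `ρ` and the unconstrained
  -- maximizer: the continuation value exceeds `y * G y / α`. A slightly better rate is then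
  -- available.
  obtain ⟨e, hde, heρ, heA⟩ : ∃ e, d < e ∧ e ≤ ρ ∧
      (1 + α) * e * (y * G m) ≤ α * (ρ * (y * G y + W)) := by
    refine ⟨min ρ (α * (ρ * (y * G y + W)) / ((1 + α) * (y * G m))), lt_min ?_ ?_,
      min_le_left _ _, ?_⟩
    · by_contra! hc'
      have := mul_le_mul_of_nonneg_right hc' hM.le
      have := mul_lt_mul_of_pos_left hGlt hρ
      linarith
    · rw [lt_div_iff₀ (by positivity)]
      linarith
    · have := min_le_right ρ (α * (ρ * (y * G y + W)) / ((1 + α) * (y * G m)))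
      rw [le_div_iff₀ (by positivity)] at this
      linarith
  have h1 := profit_strictMono hα ho.disc_mem.1 hde hB heA
  have h2 := bellman_le_optValue hρ hS.rho_lt_one hα h.toIsSurvival m ho.repay_mem
    ⟨ho.disc_mem.1.trans hde.le, heρ⟩
  rw [he, bellman, bellman, max_eq_right hmy.le, ← hWdef] at h2
  have h3 : ∀ d : ℝ, d ^ α * (y * (ρ * G y - d * G m) + ρ * W)
      = d ^ α * (ρ * (y * G y + W) - d * (y * G m)) := fun d => by ring
  rw [h3, h3] at h2
  linarith

/-- Along an optimal policy, repayment amounts below the threshold grow geometrically. -/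
lemma isOptStep_growth (hS : StationaryLoan ρ α δ K) (h : HasPeak α G z) {m₁ : ℝ}
    (hm₁ : IsThreshold α δ G z m₁) {m y d y' d' : ℝ} (hm0 : 0 ≤ m) (hmy : m < y) (hy : y < m₁)
    (ho : IsOptStep ρ α G m y d) (ho' : IsOptStep ρ α G y y' d') : y ≤ d' ^ α * d' * y' := by
  by_contra! hc
  have hα := hS.alpha_pos
  have hρ := hS.rho_pos
  have hy0 : 0 < y := hm0.trans_lt hmy
  have hy1 : y < 1 := hy.trans (hm₁.lt.trans h.peak_mem.2)
  have hM := h.pos (hmy.trans hy1)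
  have hd : 0 < d := hS.isOptStep_disc_pos h hm0 (hmy.trans hy1) ho
  have hloss := hS.isOptStep_loss h hm₁ hm0 hmy hy ho
  have hyy' := hS.isOptStep_lt h hm₁ hy0.le hy ho'
  -- Replace `y` by `v` in `[m, y]` and keep the next offer `(y', d')`. Only two terms depend on
  -- `v`: the present flow and the cost `b * G v` of the next loan. The choice `v = max b m`
  -- contradicts the loss on the present loan.
  set b := d' ^ α * d' * y' with hb
  have hb0 : 0 ≤ b := mul_nonneg (mul_nonneg (Real.rpow_nonneg ho'.disc_mem.1 _)
    ho'.disc_mem.1) ho'.repay_mem.1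
  have key : ∀ v, m ≤ v → v ≤ y →
      v * (ρ * G v - d * G m) - ρ * (b * G v) ≤ y * (ρ * G y - d * G m) - ρ * (b * G y) := by
    intro v hmv hvy
    have e1 := ho.eq
    have e2 := ho'.eq
    have i1 := bellman_le_optValue hρ hS.rho_lt_one hα h.toIsSurvival m
      (y := v) ⟨hm0.trans hmv, hvy.trans hy1.le⟩ ho.disc_mem
    have i2 := bellman_le_optValue hρ hS.rho_lt_one hα h.toIsSurvival v
      ho'.repay_mem ho'.disc_mem
    rw [e1] at i1
    rw [bellman, max_eq_right hmv, bellman, max_eq_right hmy.le] at i1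
    rw [bellman, max_eq_right (hvy.trans hyy'.le)] at i2
    rw [bellman, max_eq_right hyy'.le] at e2
    have i3 := le_of_mul_le_mul_left i1 (Real.rpow_pos_of_pos hd α)
    have i4 := mul_le_mul_of_nonneg_left i2 hρ.le
    rw [e2] at i3
    rw [hb]
    linarith
  have hloss' : (y - b) * (ρ * G y) < (y - b) * (d * G m) :=
    mul_lt_mul_of_pos_left hloss (sub_pos.2 hc)
  rcases le_total m b with hmb | hmb
  · have := key b hmb hc.le
    linarith
  · have h1 := key m le_rfl hmy.le
    have h2 : 0 ≤ (ρ - d) * ((m - b) * G m) :=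
      mul_nonneg (sub_nonneg.2 ho.disc_mem.2) (mul_nonneg (sub_nonneg.2 hmb) hM.le)
    linarith

end StationaryLoan

end

/-! ### Finite screening plans and the full-information bound -/

section

/-- The expected loss from the screening loans that are encoded in a list of weights and repayment
amounts. -/
def screeningCost (L : List (ℝ × ℝ)) (G : ℝ → ℝ) : ℝ :=
  (L.map fun p => p.1 * G p.2).sum

@[simp]
lemma screeningCost_nil (G : ℝ → ℝ) : screeningCost [] G = 0 := rfl

@[simp]
lemma screeningCost_cons (p : ℝ × ℝ) (L : List (ℝ × ℝ)) (G : ℝ → ℝ) :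
    screeningCost (p :: L) G = p.1 * G p.2 + screeningCost L G := by
  simp [screeningCost]

lemma screeningCost_scale (c : ℝ) (L : List (ℝ × ℝ)) (G : ℝ → ℝ) :
    screeningCost (L.map fun p => (c * p.1, p.2)) G = c * screeningCost L G := by
  induction L with
  | nil => simp
  | cons p L ih => rw [List.map_cons, screeningCost_cons, ih, screeningCost_cons]; ring

variable {ρ α δ K : ℝ} {G : ℝ → ℝ} {z : ℝ}

namespace StationaryLoan

lemma optValue_peak (hS : StationaryLoan ρ α δ K) (h : HasPeak α G z) {m₁ : ℝ}
    (hm₁ : IsThreshold α δ G z m₁) : optValue ρ α G z = K * (z * G z) := by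
  have hz := h.peak_mem
  refine le_antisymm ?_ (hS.mul_le_optValue h.toIsSurvival ⟨hz.1.le, hz.2.le⟩)
  refine (hS.optValue_le_of_threshold_le h hm₁ hm₁.lt.le).trans (le_of_eq ?_)
  have hg := h.pos hz.2
  have := Real.rpow_pos_of_pos hg α
  rw [max_self, Real.rpow_neg hg.le, Real.rpow_one_add' hg.le (by linarith [hS.alpha_pos])]
  field_simp

/-- Induction on the number of factors `ρ` separating the first offer from `m₁`; growth by at least
`1 / ρ` per step makes it terminate. The first step may be changed, since an offer beyond the
threshold is replaced by the jump to `z`. Allowing any earlier record `v ≤ m` under `G'` lets plans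
be concatenated. -/
lemma exists_plan_of_le (hS : StationaryLoan ρ α δ K) (h : HasPeak α G z) {m₁ : ℝ}
    (hm₁ : IsThreshold α δ G z m₁) (k : ℕ) : ∀ {m y d : ℝ}, 0 ≤ m → m < m₁ →
    IsOptStep ρ α G m y d → m₁ * ρ ^ k ≤ y →
    ∃ y' d' L P, IsOptStep ρ α G m y' d' ∧ 0 < P ∧ (∀ p ∈ L, 0 ≤ p.1 ∧ 0 < p.2 ∧ p.2 < m₁) ∧
      optValue ρ α G m = -(d' ^ α * d' * y') * G m - screeningCost L G + P * G z ∧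
      ∀ G', IsSurvival G' → ∀ v, 0 ≤ v → v ≤ m →
        -(d' ^ α * d' * y') * G' v - screeningCost L G' + P * G' z ≤ optValue ρ α G' v := by
  have hα := hS.alpha_pos
  have hρ := hS.rho_pos
  have hz := h.peak_mem
  have hzm : z ∈ Set.Icc (0 : ℝ) 1 := ⟨hz.1.le, hz.2.le⟩
  have hjump : ∀ {m y d : ℝ}, 0 ≤ m → m < m₁ → IsOptStep ρ α G m y d → m₁ ≤ y →
    ∃ y' d' L P, IsOptStep ρ α G m y' d' ∧ 0 < P ∧ (∀ p ∈ L, 0 ≤ p.1 ∧ 0 < p.2 ∧ p.2 < m₁) ∧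
      optValue ρ α G m = -(d' ^ α * d' * y') * G m - screeningCost L G + P * G z ∧
      ∀ G', IsSurvival G' → ∀ v, 0 ≤ v → v ≤ m →
        -(d' ^ α * d' * y') * G' v - screeningCost L G' + P * G' z ≤ optValue ρ α G' v := by
    intro m y d hm0 hm ho hy
    have hp := hS.isOptStep_peak h hm₁ hm0 hm hy ho
    have hmz : m < z := hm.trans hm₁.lt
    set d' := δ * (G z / G m)
    have hd' := hS.isOptStep_disc_pos h hm0 (hmz.trans hz.2) hp
    refine ⟨z, d', [], ρ * d' ^ α * ((1 + K) * z), hp, ?_, by simp, ?_, ?_⟩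
    · have := Real.rpow_pos_of_pos hd' α
      have := hS.value_pos
      have := hz.1
      positivity
    · rw [hp.eq, bellman, max_eq_right hmz.le, hS.optValue_peak h hm₁, screeningCost_nil]
      ring
    · intro G' hG' v hv0 hvm
      refine le_trans ?_ (bellman_le_optValue hρ hS.rho_lt_one hα hG' v hzm hp.disc_mem)
      rw [bellman, max_eq_right (hvm.trans hmz.le), screeningCost_nil]
      have h1 := mul_le_mul_of_nonneg_left (hS.mul_le_optValue hG' hzm)
        (mul_nonneg hρ.le (Real.rpow_nonneg hd'.le α))
      linarith
  induction k with
  | zero =>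
    intro m y d hm0 hm ho hy
    exact hjump hm0 hm ho (by simpa using hy)
  | succ k ih =>
    intro m y d hm0 hm ho hy
    rcases le_or_gt m₁ y with hy1 | hy1
    · exact hjump hm0 hm ho hy1
    have hmy := hS.isOptStep_lt h hm₁ hm0 hm ho
    have hy0 : 0 < y := hm0.trans_lt hmy
    obtain ⟨y₂, d₂, ho₂⟩ := exists_isOptStep hρ hS.rho_lt_one hα h.toIsSurvival y
    have hgr := hS.isOptStep_growth h hm₁ hm0 hmy hy1 ho ho₂
    have hk : m₁ * ρ ^ k ≤ y₂ := by
      have h1 : d₂ ^ α ≤ 1 :=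
        Real.rpow_le_one ho₂.disc_mem.1 (ho₂.disc_mem.2.trans hS.rho_lt_one.le) hα.le
      have h2 : d₂ ^ α * d₂ ≤ ρ := by
        calc d₂ ^ α * d₂ ≤ 1 * d₂ := mul_le_mul_of_nonneg_right h1 ho₂.disc_mem.1
          _ ≤ ρ := by rw [one_mul]; exact ho₂.disc_mem.2
      have h3 := mul_le_mul_of_nonneg_right h2 ho₂.repay_mem.1
      rw [pow_succ] at hy
      refine le_of_mul_le_mul_left ?_ hρ
      linarith
    obtain ⟨y', d', L, P, ho', hP, hL, hV, hG'⟩ := ih hy0.le hy1 ho₂ hk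
    have hgr' := hS.isOptStep_growth h hm₁ hm0 hmy hy1 ho ho'
    set e := d' ^ α * d' * y'
    have hd := hS.isOptStep_disc_pos h hm0 (hm.trans (hm₁.lt.trans hz.2)) ho
    have hc : 0 < ρ * d ^ α := mul_pos hρ (Real.rpow_pos_of_pos hd α)
    -- The loan `y` earns `y * G y` when repaid, while the next loan costs `e * G y`; the net weight
    -- `e - y` is nonnegative by the growth estimate.
    refine ⟨y, d, (ρ * d ^ α * (e - y), y) :: L.map fun p => (ρ * d ^ α * p.1, p.2),
      ρ * d ^ α * P, ho, mul_pos hc hP, ?_, ?_, ?_⟩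
    · intro p hp
      rcases List.mem_cons.1 hp with rfl | hp
      · exact ⟨mul_nonneg hc.le (sub_nonneg.2 hgr'), hy0, hy1⟩
      · obtain ⟨p', hp', rfl⟩ := List.mem_map.1 hp
        obtain ⟨h1, h2, h3⟩ := hL p' hp'
        exact ⟨mul_nonneg hc.le h1, h2, h3⟩
    · rw [ho.eq, bellman, max_eq_right hmy.le, hV, screeningCost_cons, screeningCost_scale]
      ring
    · intro G' hG'' v hv0 hvm
      refine le_trans ?_ (bellman_le_optValue hρ hS.rho_lt_one hα hG'' v ho.repay_mem ho.disc_mem)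
      rw [bellman, max_eq_right (hvm.trans hmy.le), screeningCost_cons, screeningCost_scale]
      have h1 := mul_le_mul_of_nonneg_left (hG' G' hG'' y hy0.le le_rfl) hc.le
      linarith

/-- An optimal policy consists of finitely many screening loans, made at a loss, with repayment
amounts below the mode, after which the repayment amount stays at the mode. Hence the optimal
value is an affine function of the survival probabilities, with nonpositive coefficients except
at the mode. The policy is feasible, and has the value of the same form, for every other
survival function. -/
theorem exists_plan (hS : StationaryLoan ρ α δ K) (h : HasPeak α G z) :
    ∃ m₁ e L P, 0 < m₁ ∧ m₁ < z ∧ 0 ≤ e ∧ 0 < P ∧ (∀ p ∈ L, 0 ≤ p.1 ∧ 0 < p.2 ∧ p.2 < m₁) ∧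
      optValue ρ α G 0 = -e - screeningCost L G + P * G z ∧
      ∀ G', IsSurvival G' → -e - screeningCost L G' + P * G' z ≤ optValue ρ α G' 0 := by
  obtain ⟨m₁, hm₁⟩ := exists_isThreshold hS h
  obtain ⟨y, d, ho⟩ := exists_isOptStep hS.rho_pos hS.rho_lt_one hS.alpha_pos h.toIsSurvival 0
  have hy := hS.isOptStep_lt h hm₁ le_rfl hm₁.pos ho
  obtain ⟨k, hk⟩ := exists_pow_lt_of_lt_one (div_pos hy hm₁.pos) hS.rho_lt_one
  rw [lt_div_iff₀ hm₁.pos, mul_comm] at hk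
  obtain ⟨y', d', L, P, ho', hP, hL, hV, hG'⟩ :=
    hS.exists_plan_of_le h hm₁ k le_rfl hm₁.pos ho hk.le
  refine ⟨m₁, d' ^ α * d' * y', L, P, hm₁.pos, hm₁.lt, ?_, hP, hL, ?_, ?_⟩
  · exact mul_nonneg (mul_nonneg (Real.rpow_nonneg ho'.disc_mem.1 _)
      ho'.disc_mem.1) ho'.repay_mem.1
  · rw [hV, h.zero, mul_one]
  · intro G' hG''
    have := hG' G' hG'' 0 le_rfl le_rfl
    rwa [hG''.zero, mul_one] at this

/-- The value is at most that of a lender who knows the income. -/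
lemma optValue_zero_le (hS : StationaryLoan ρ α δ K) (hG : IsSurvival G) {T : ℝ → ℝ}
    (hT : AntitoneOn T (Set.Ici 0)) (hTG : ∀ y, 0 ≤ y → y * G y ≤ T y) :
    optValue ρ α G 0 ≤ K * T 0 := by
  have hK := hS.value_pos
  have hT0 : ∀ y, 0 ≤ y → 0 ≤ T y := fun y hy =>
    (mul_nonneg hy (hG.nonneg y)).trans (hTG y hy)
  refine optValue_le_of_bellman_le (m₀ := 0) (W := fun m => K * T m) hS.rho_pos hS.rho_lt_one
    hS.alpha_pos hG (fun m hm => mul_nonneg hK.le (hT0 m hm)) ?_ le_rfl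
  intro m hm y hy d hd
  rw [bellman]
  have hmax : 0 ≤ max m y := le_max_of_le_left hm
  have h1 : T (max m y) ≤ T m := hT hm hmax (le_max_left _ _)
  have h2 : y * G (max m y) ≤ T (max m y) :=
    (mul_le_mul_of_nonneg_right (le_max_right _ _) (hG.nonneg _)).trans (hTG _ hmax)
  have h3 := hG.antitone (le_max_left m y)
  have h4 := hS.profit_le_value hd.1
  have h5 := hT0 _ hmax
  have h6 := Real.rpow_nonneg hd.1 α
  -- The loan is financed for at least the mass `G (max m y)` that repays, so its profit is at most
  -- a margin `ρ - d` on that mass; `profit_le_value` then bounds the whole step.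
  have h7 : y * (ρ * G (max m y) - d * G m) ≤ (ρ - d) * T (max m y) := by
    have a := mul_le_mul_of_nonneg_left h3 (mul_nonneg hy.1 hd.1)
    have b := mul_le_mul_of_nonneg_left h2 (sub_nonneg.2 hd.2)
    linarith
  calc d ^ α * (y * (ρ * G (max m y) - d * G m) + ρ * (K * T (max m y)))
      ≤ d ^ α * ((ρ - d) * T (max m y) + ρ * (K * T (max m y))) := by gcongr
    _ = d ^ α * (ρ * (1 + K) - d) * T (max m y) := by ring
    _ ≤ K * T (max m y) := mul_le_mul_of_nonneg_right h4 h5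
    _ ≤ K * T m := mul_le_mul_of_nonneg_left h1 hK.le

end StationaryLoan

end

section

/-! ### Lending policies -/

lemma le_record {m : ℝ} {y : ℕ → ℝ} {s t : ℕ} (h : s < t) : y s ≤ record m y t := by
  induction t with
  | zero => exact absurd h (Nat.not_lt_zero _)
  | succ t ih =>
    rcases (Nat.lt_succ_iff_lt_or_eq.1 h) with h | rfl
    · exact (ih h).trans (le_max_left _ _)
    · exact le_max_right _ _

lemma record_min_one {m : ℝ} (hm : m ≤ 1) (y : ℕ → ℝ) (t : ℕ) :
    record m (fun i => min (y i) 1) t = min (record m y t) 1 := by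
  induction t with
  | zero => exact (min_eq_left hm).symm
  | succ t ih => 
    simp only [record, ih]
    exact (min_max_distrib_right _ _ _).symm

lemma IsSurvival.apply_min_one {G : ℝ → ℝ} (hG : IsSurvival G) (y : ℝ) : G (min y 1) = G y := by
  rcases le_total y 1 with h | h
  · rw [min_eq_left h]
  · rw [min_eq_right h, hG.eq_zero y h, hG.eq_zero 1 le_rfl]

variable {ρ α : ℝ} {G : ℝ → ℝ}

/-- A repayment amount above `1` is never repaid, and lowering it to `1` only reduces the loss on
that loan. -/
lemma flow_le_flow_min_one (hρ : 0 < ρ) (hG : IsSurvival G) {q : ℕ → ℝ × ℝ}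
    (hd : ∀ t, 0 ≤ (q t).2) (t : ℕ) :
    flow ρ α G 0 q t ≤ flow ρ α G 0 (fun i => (min (q i).1 1, (q i).2)) t := by
  simp only [flow]
  rw [record_min_one zero_le_one, record_min_one zero_le_one, hG.apply_min_one, hG.apply_min_one]
  refine mul_le_mul_of_nonneg_left ?_ (mul_nonneg (pow_nonneg hρ.le t)
    (Finset.prod_nonneg fun i _ => Real.rpow_nonneg (hd i) _))
  rcases le_total (q t).1 1 with h | h
  · rw [min_eq_left h]
  · rw [min_eq_right h, hG.eq_zero _ (h.trans (le_record (y := fun i => (q i).1) (Nat.lt_succ_self t)))]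
    have := mul_nonneg (hd t) (hG.nonneg (record 0 (fun i => (q i).1) t))
    nlinarith

/-- Either all amounts lie in `[0, 1]` and the geometric bound applies, or some amount exceeds `1`
and all later flows vanish. -/
lemma summable_flow_of_nonneg (hρ0 : 0 < ρ) (hρ1 : ρ < 1) (hα : 0 < α) (hG : IsSurvival G)
    {q : ℕ → ℝ × ℝ} (hy : ∀ t, 0 ≤ (q t).1) (hd : ∀ t, (q t).2 ∈ Set.Icc 0 ρ) :
    Summable (flow ρ α G 0 q) := by
  by_cases h : ∀ t, (q t).1 ≤ 1
  · exact summable_flow hρ0 hρ1 hα hG 0 fun t _ => ⟨⟨hy t, h t⟩, hd t⟩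
  · push Not at h
    obtain ⟨N, hN⟩ := h
    refine summable_of_ne_finset_zero (s := Finset.range (N + 1)) fun t ht => ?_
    have ht' : N < t := by simpa [Nat.lt_succ_iff] using ht
    rw [flow, hG.eq_zero _ (hN.le.trans (le_record (y := fun i => (q i).1)
      (ht'.trans (Nat.lt_succ_self t)))),
      hG.eq_zero _ (hN.le.trans (le_record (y := fun i => (q i).1) ht'))]
    simp

lemma tsum_flow_le_optValue (hρ0 : 0 < ρ) (hρ1 : ρ < 1) (hα : 0 < α) (hG : IsSurvival G)
    {q : ℕ → ℝ × ℝ} (hy : ∀ t, 0 ≤ (q t).1) (hd : ∀ t, (q t).2 ∈ Set.Icc 0 ρ) :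
    ∑' t, flow ρ α G 0 q t ≤ optValue ρ α G 0 := by
  have hq : (fun i => (min (q i).1 1, (q i).2)) ∈ admissible ρ := fun t _ =>
    ⟨⟨le_min (hy t) zero_le_one, min_le_right _ _⟩, hd t⟩
  exact ((summable_flow_of_nonneg hρ0 hρ1 hα hG hy hd).tsum_le_tsum
    (flow_le_flow_min_one hρ0 hG fun t => (hd t).1)
    (summable_flow hρ0 hρ1 hα hG 0 hq)).trans (npv_le_optValue hρ0 hρ1 hα hG 0 hq)

/-- The survival function of a law. -/
noncomputable def survival (μ : Measure ℝ) (y : ℝ) : ℝ := μ.real (Set.Ici y)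

namespace LendingPolicy

variable {μ : Measure ℝ} [IsProbabilityMeasure μ]

lemma measurableSet_history (p : LendingPolicy ρ) (t : ℕ) : MeasurableSet (p.history t) := by
  have : p.history t = ⋂ i, ⋂ (_ : i < t), Set.Ici (p.repay i) := by
    ext θ
    simp [history]
  rw [this]
  exact MeasurableSet.iInter fun i => MeasurableSet.iInter fun _ => measurableSet_Ici

lemma history_succ (p : LendingPolicy ρ) (t : ℕ) :
    p.history (t + 1) = p.history t ∩ Set.Ici (p.repay t) := by
  ext θ
  simp only [history, Set.mem_ofPred_eq, Set.mem_inter_iff, Set.mem_Ici]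
  constructor
  · exact fun h => ⟨fun i hi => h i (hi.trans (Nat.lt_succ_self t)), h t (Nat.lt_succ_self t)⟩
  · rintro ⟨h1, h2⟩ i hi
    rcases (Nat.lt_succ_iff_lt_or_eq.1 hi) with h | rfl
    · exact h1 i h
    · exact h2

lemma history_inter_Ici (p : LendingPolicy ρ) (t : ℕ) :
    p.history t ∩ Set.Ici 0 = Set.Ici (record 0 p.repay t) := by
  induction t with
  | zero => simp [history, record]
  | succ t ih => rw [history_succ, Set.inter_right_comm, ih, record, Set.Ici_inter_Ici]

lemma real_history (hG : survival μ 0 = 1) (p : LendingPolicy ρ) (t : ℕ) :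
    μ.real (p.history t) = survival μ (record 0 p.repay t) := by
  rw [survival, ← history_inter_Ici, measureReal_def, measureReal_def]
  congr 1
  rw [Set.inter_comm]
  refine (Measure.measure_inter_eq_of_ae ?_).symm
  rw [survival, measureReal_def, ENNReal.toReal_eq_one_iff] at hG
  exact (mem_ae_iff_prob_eq_one measurableSet_Ici).2 hG

lemma repayProb_eq (hG : survival μ 0 = 1) (p : LendingPolicy ρ) (t : ℕ) :
    p.repayProb μ t
      = (survival μ (record 0 p.repay t))⁻¹ * survival μ (record 0 p.repay (t + 1)) := by
  rw [← real_history hG, ← real_history hG, history_succ, repayProb, measureReal_def,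
    cond_apply (p.measurableSet_history t), ENNReal.toReal_mul, ENNReal.toReal_inv]
  rfl

lemma survival_mul_repayProb (hG : IsSurvival (survival μ)) (p : LendingPolicy ρ) (t : ℕ) :
    survival μ (record 0 p.repay t) * p.repayProb μ t
      = survival μ (record 0 p.repay (t + 1)) := by
  rw [repayProb_eq hG.zero]
  -- When the history has probability zero, the next survival probability is also zero by
  -- monotonicity, so the product formula needs no convention.
  rcases eq_or_ne (survival μ (record 0 p.repay t)) 0 with h | h
  · have h1 : survival μ (record 0 p.repay (t + 1)) ≤ survival μ (record 0 p.repay t) :=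
      hG.antitone (le_max_left _ _)
    rw [h] at h1
    rw [h, zero_mul, le_antisymm h1 (hG.nonneg _)]
  · field_simp

lemma prod_repayProb (hG : IsSurvival (survival μ)) (p : LendingPolicy ρ) (t : ℕ) :
    ∏ i ∈ Finset.range t, p.repayProb μ i = survival μ (record 0 p.repay t) := by
  induction t with
  | zero => simp [record, hG.zero]
  | succ t ih => rw [Finset.prod_range_succ, ih, survival_mul_repayProb hG]

lemma cashFlow_eq_flow (hG : IsSurvival (survival μ)) (p : LendingPolicy ρ) (t : ℕ) :
    p.cashFlow (constElasticityDemand α) μ t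
      = flow ρ α (survival μ) 0 (fun i => (p.repay i, p.disc i)) t := by
  simp only [cashFlow, flow, constElasticityDemand]
  rw [Finset.prod_mul_distrib, prod_repayProb hG, Finset.prod_range_succ,
    ← survival_mul_repayProb hG]
  ring

lemma summable_cashFlow (hρ0 : 0 < ρ) (hρ1 : ρ < 1) (hα : 0 < α)
    (hG : IsSurvival (survival μ)) (p : LendingPolicy ρ) :
    Summable fun t => p.cashFlow (constElasticityDemand α) μ t := by
  simp only [cashFlow_eq_flow hG]
  exact summable_flow_of_nonneg hρ0 hρ1 hα hG p.repay_nonneg p.disc_mem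

lemma isGreatest_optValue (hρ0 : 0 < ρ) (hρ1 : ρ < 1) (hα : 0 < α)
    (hG : IsSurvival (survival μ)) :
    IsGreatest (Set.range fun p : LendingPolicy ρ =>
      p.expectedNPV (constElasticityDemand α) μ) (optValue ρ α (survival μ) 0) := by
  constructor
  · obtain ⟨q, hq, h⟩ := exists_npv_eq_optValue hρ0 hρ1 hα hG 0
    have hq' := fun t => hq t trivial
    refine ⟨⟨fun t => (q t).1, fun t => (q t).2, fun t => (hq' t).1.1, fun t => (hq' t).2⟩, ?_⟩
    simp only [expectedNPV, cashFlow_eq_flow hG]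
    exact h
  · rintro _ ⟨p, rfl⟩
    simp only [expectedNPV, cashFlow_eq_flow hG]
    exact tsum_flow_le_optValue hρ0 hρ1 hα hG p.repay_nonneg p.disc_mem

lemma optimalNPV_eq_optValue (hρ0 : 0 < ρ) (hρ1 : ρ < 1) (hα : 0 < α)
    (hG : IsSurvival (survival μ)) :
    optimalNPV ρ (constElasticityDemand α) μ = optValue ρ α (survival μ) 0 :=
  (isGreatest_optValue hρ0 hρ1 hα hG).csSup_eq

end LendingPolicy

end

/-! ### The symmetric Beta law -/

lemma betaPDFReal_nonneg {a b : ℝ} (ha : 0 < a) (hb : 0 < b) (x : ℝ) : 0 ≤ betaPDFReal a b x := by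
  by_cases h : 0 < x ∧ x < 1
  · exact (betaPDFReal_pos h.1 h.2 ha hb).le
  · rw [betaPDFReal, if_neg h]

lemma integrable_betaPDFReal {a b : ℝ} (ha : 0 < a) (hb : 0 < b) :
    Integrable (betaPDFReal a b) := by
  refine ⟨(measurable_betaPDFReal a b).aestronglyMeasurable, ?_⟩
  rw [hasFiniteIntegral_iff_ofReal (Filter.Eventually.of_forall (betaPDFReal_nonneg ha hb))]
  have := lintegral_betaPDF_eq_one ha hb
  simp only [betaPDF] at this
  rw [this]
  exact ENNReal.one_lt_top

lemma integral_betaPDFReal {a b : ℝ} (ha : 0 < a) (hb : 0 < b) :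
    ∫ x, betaPDFReal a b x = 1 := by
  rw [integral_eq_lintegral_of_nonneg_ae
    (Filter.Eventually.of_forall (betaPDFReal_nonneg ha hb))
    (measurable_betaPDFReal a b).aestronglyMeasurable]
  have := lintegral_betaPDF_eq_one ha hb
  simp only [betaPDF] at this
  rw [this, ENNReal.toReal_one]

lemma integral_betaMeasure {a b : ℝ} (ha : 0 < a) (hb : 0 < b) (g : ℝ → ℝ) :
    ∫ x, g x ∂betaMeasure a b = ∫ x, betaPDFReal a b x * g x := by
  rw [betaMeasure, integral_withDensity_eq_integral_toReal_smul]
  · refine integral_congr_ae (Filter.Eventually.of_forall fun x => ?_)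
    simp only [betaPDF, smul_eq_mul]
    rw [ENNReal.toReal_ofReal (betaPDFReal_nonneg ha hb x)]
  · exact (measurable_betaPDFReal a b).ennreal_ofReal
  · exact Filter.Eventually.of_forall fun x => ENNReal.ofReal_lt_top

lemma integrable_betaMeasure_iff {a b : ℝ} (ha : 0 < a) (hb : 0 < b) (g : ℝ → ℝ) :
    Integrable g (betaMeasure a b) ↔ Integrable fun x => betaPDFReal a b x * g x := by
  rw [betaMeasure, integrable_withDensity_iff_integrable_smul']
  · refine integrable_congr (Filter.Eventually.of_forall fun x => ?_)
    simp only [betaPDF, smul_eq_mul]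
    rw [ENNReal.toReal_ofReal (betaPDFReal_nonneg ha hb x)]
  · exact (measurable_betaPDFReal a b).ennreal_ofReal
  · exact Filter.Eventually.of_forall fun x => ENNReal.ofReal_lt_top

lemma beta_add_one_left {a b : ℝ} (ha : 0 < a) (hb : 0 < b) :
    beta (a + 1) b = a / (a + b) * beta a b := by
  have h1 : Real.Gamma (a + b) ≠ 0 := (Real.Gamma_pos_of_pos (by positivity)).ne'
  rw [beta, beta, Real.Gamma_add_one ha.ne', show a + 1 + b = a + b + 1 by ring,
    Real.Gamma_add_one (by positivity)]
  have : a + b ≠ 0 := by positivity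
  field_simp

lemma betaPDFReal_mul_self {a b : ℝ} (ha : 0 < a) (hb : 0 < b) (x : ℝ) :
    betaPDFReal a b x * x = a / (a + b) * betaPDFReal (a + 1) b x := by
  have h1 := beta_pos ha hb
  rw [betaPDFReal, betaPDFReal]
  split_ifs with h
  · rw [beta_add_one_left ha hb, show a + 1 - 1 = a - 1 + 1 by ring, Real.rpow_add_one h.1.ne']
    have : a + b ≠ 0 := by positivity
    field_simp
  · ring

lemma betaPDFReal_mul_sq {a b : ℝ} (ha : 0 < a) (hb : 0 < b) (x : ℝ) :
    betaPDFReal a b x * x ^ 2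
      = a / (a + b) * ((a + 1) / (a + 1 + b)) * betaPDFReal (a + 2) b x := by
  have h := betaPDFReal_mul_self (a := a + 1) (b := b) (by positivity) hb x
  rw [show a + 1 + 1 = a + 2 by ring] at h
  rw [pow_two, ← mul_assoc, betaPDFReal_mul_self ha hb, mul_assoc, h]
  ring

lemma integral_symmBeta_id {a : ℝ} (ha : 0 < a) : ∫ x, x ∂symmBeta a = 1 / 2 := by
  rw [symmBeta, integral_betaMeasure ha ha]
  simp_rw [betaPDFReal_mul_self ha ha]
  rw [integral_const_mul, integral_betaPDFReal (by positivity) ha]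
  field_simp
  norm_num

lemma isProbabilityMeasure_symmBeta {a : ℝ} (ha : 0 < a) : IsProbabilityMeasure (symmBeta a) :=
  isProbabilityMeasureBeta ha ha

lemma memLp_id_symmBeta {a : ℝ} (ha : 0 < a) : MemLp id 2 (symmBeta a) := by
  rw [memLp_two_iff_integrable_sq measurable_id.aestronglyMeasurable, symmBeta,
    integrable_betaMeasure_iff ha ha]
  simp only [id_eq]
  simp_rw [betaPDFReal_mul_sq ha ha]
  exact (integrable_betaPDFReal (by positivity) ha).const_mul _

lemma integrable_id_symmBeta {a : ℝ} (ha : 0 < a) : Integrable (fun x => x) (symmBeta a) := by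
  rw [symmBeta, integrable_betaMeasure_iff ha ha]
  simp_rw [betaPDFReal_mul_self ha ha]
  exact (integrable_betaPDFReal (by positivity) ha).const_mul _

lemma incomeVar_eq {a : ℝ} (ha : 0 < a) : incomeVar a = 1 / (4 * (2 * a + 1)) := by
  have := isProbabilityMeasure_symmBeta ha
  have h1 : ∫ x, (id ^ 2 : ℝ → ℝ) x ∂symmBeta a = (a + 1) / (2 * (2 * a + 1)) := by
    rw [symmBeta, integral_betaMeasure ha ha]
    simp only [Pi.pow_apply, id_eq]
    simp_rw [betaPDFReal_mul_sq ha ha]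
    rw [integral_const_mul, integral_betaPDFReal (by positivity) ha]
    field_simp
    ring
  rw [incomeVar, variance_eq_sub (memLp_id_symmBeta ha), h1]
  simp only [id_eq]
  rw [integral_symmBeta_id ha]
  field_simp
  ring

/-! ### Distribution function, failure rate and mode -/

/-- The distribution function of the symmetric Beta law. -/
noncomputable def betaCDF (a y : ℝ) : ℝ := ∫ x in (0 : ℝ)..y, betaPDFReal a a x

lemma intervalIntegrable_betaPDFReal {a : ℝ} (ha : 0 < a) (x y : ℝ) :
    IntervalIntegrable (betaPDFReal a a) volume x y :=
  (integrable_betaPDFReal ha ha).intervalIntegrable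

lemma betaCDF_sub {a : ℝ} (ha : 0 < a) (x y : ℝ) :
    betaCDF a y - betaCDF a x = ∫ t in x..y, betaPDFReal a a t :=
  intervalIntegral.integral_interval_sub_left (intervalIntegrable_betaPDFReal ha _ _)
    (intervalIntegrable_betaPDFReal ha _ _)

lemma monotone_betaCDF {a : ℝ} (ha : 0 < a) : Monotone (betaCDF a) := by
  intro x y hxy
  rw [← sub_nonneg, betaCDF_sub ha]
  exact intervalIntegral.integral_nonneg hxy fun t _ => betaPDFReal_nonneg ha ha t

@[simp]
lemma betaCDF_zero (a : ℝ) : betaCDF a 0 = 0 := intervalIntegral.integral_same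

lemma betaPDFReal_symm (a x : ℝ) : betaPDFReal a a (1 - x) = betaPDFReal a a x := by
  rw [betaPDFReal, betaPDFReal]
  by_cases h : 0 < x ∧ x < 1
  · rw [if_pos h, if_pos ⟨by linarith, by linarith⟩, sub_sub_cancel]
    ring
  · rw [if_neg h, if_neg]
    rintro ⟨h1, h2⟩
    exact h ⟨by linarith, by linarith⟩

lemma survival_symmBeta {a : ℝ} (ha : 0 < a) (y : ℝ) :
    survival (symmBeta a) y = 1 - betaCDF a y := by
  have hf := integrable_betaPDFReal ha ha
  have h1 : survival (symmBeta a) y = ∫ x in Set.Ioi y, betaPDFReal a a x := by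
    rw [survival, symmBeta, betaMeasure, measureReal_def, withDensity_apply _ measurableSet_Ici,
      integral_eq_lintegral_of_nonneg_ae
        (Filter.Eventually.of_forall (betaPDFReal_nonneg ha ha))
        (measurable_betaPDFReal a a).aestronglyMeasurable,
      restrict_Ioi_eq_restrict_Ici]
    rfl
  have h0 : ∫ x in Set.Iic (0 : ℝ), betaPDFReal a a x = 0 := by
    refine setIntegral_eq_zero_of_forall_eq_zero fun x hx => ?_
    rw [betaPDFReal, if_neg]
    exact fun h => absurd h.1 (not_lt.2 hx)
  have h2 := intervalIntegral.integral_Iic_add_Ioi (b := y) hf.integrableOn hf.integrableOn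
  have h3 := intervalIntegral.integral_Iic_sub_Iic (a := 0) (b := y) hf.integrableOn
    hf.integrableOn
  rw [integral_betaPDFReal ha ha] at h2
  rw [h0] at h3
  rw [h1, betaCDF]
  linarith

lemma betaCDF_one {a : ℝ} (ha : 0 < a) : betaCDF a 1 = 1 := by
  have h1 : survival (symmBeta a) 1 = 0 := by
    rw [survival, symmBeta, betaMeasure, measureReal_def, withDensity_apply _ measurableSet_Ici,
      setLIntegral_eq_zero measurableSet_Ici fun x hx => betaPDF_eq_zero_of_one_le hx,
      ENNReal.toReal_zero]
  rw [survival_symmBeta ha] at h1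
  linarith

lemma betaCDF_symm {a : ℝ} (ha : 0 < a) (y : ℝ) : betaCDF a (1 - y) = 1 - betaCDF a y := by
  have h1 : ∫ x in (0 : ℝ)..y, betaPDFReal a a (1 - x)
      = ∫ x in (1 - y)..(1 - 0), betaPDFReal a a x :=
    intervalIntegral.integral_comp_sub_left _ 1
  simp only [betaPDFReal_symm, sub_zero] at h1
  rw [← betaCDF_sub ha (1 - y) 1, betaCDF_one ha] at h1
  change betaCDF a y = _ at h1
  linarith

lemma betaCDF_half {a : ℝ} (ha : 0 < a) : betaCDF a (1 / 2) = 1 / 2 := by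
  have := betaCDF_symm ha (1 / 2)
  norm_num at this ⊢
  linarith

lemma continuous_betaCDF {a : ℝ} (ha : 0 < a) : Continuous (betaCDF a) :=
  intervalIntegral.continuous_primitive (fun x y => intervalIntegrable_betaPDFReal ha x y) 0

lemma betaPDFReal_eq {a x : ℝ} (hx : x ∈ Set.Ioo (0 : ℝ) 1) :
    betaPDFReal a a x = (beta a a)⁻¹ * (x * (1 - x)) ^ (a - 1) := by
  rw [betaPDFReal, if_pos (Set.mem_Ioo.1 hx), Real.mul_rpow hx.1.le (sub_nonneg.2 hx.2.le), one_div, mul_assoc]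

lemma continuousOn_betaPDFReal (a : ℝ) : ContinuousOn (betaPDFReal a a) (Set.Ioo 0 1) := by
  have : ContinuousOn (fun x : ℝ => (beta a a)⁻¹ * (x * (1 - x)) ^ (a - 1)) (Set.Ioo 0 1) := by
    refine continuousOn_const.mul (ContinuousOn.rpow_const (by fun_prop) fun x hx => Or.inl ?_)
    exact (mul_pos hx.1 (sub_pos.2 hx.2)).ne'
  exact this.congr fun x hx => betaPDFReal_eq hx

lemma hasDerivAt_betaCDF {a : ℝ} (ha : 0 < a) {y : ℝ} (hy : y ∈ Set.Ioo (0 : ℝ) 1) :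
    HasDerivAt (betaCDF a) (betaPDFReal a a y) y :=
  intervalIntegral.integral_hasDerivAt_right (intervalIntegrable_betaPDFReal ha 0 y)
    ((stronglyMeasurable_betaPDFReal a a).stronglyMeasurableAtFilter)
    ((continuousOn_betaPDFReal a).continuousAt (Ioo_mem_nhds hy.1 hy.2))

lemma strictMonoOn_betaCDF {a : ℝ} (ha : 0 < a) : StrictMonoOn (betaCDF a) (Set.Icc 0 1) := by
  refine strictMonoOn_of_deriv_pos (convex_Icc 0 1) (continuous_betaCDF ha).continuousOn ?_
  intro x hx
  rw [interior_Icc] at hx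
  rw [(hasDerivAt_betaCDF ha hx).deriv]
  exact betaPDFReal_pos hx.1 hx.2 ha ha

lemma isSurvival_symmBeta {a : ℝ} (ha : 0 < a) : IsSurvival (survival (symmBeta a)) := by
  have := isProbabilityMeasure_symmBeta ha
  have hs : survival (symmBeta a) = fun y => 1 - betaCDF a y := funext (survival_symmBeta ha)
  have hanti : Antitone (survival (symmBeta a)) := by
    rw [hs]
    exact fun x y h => sub_le_sub_left (monotone_betaCDF ha h) 1
  refine ⟨?_, hanti, ?_, fun y => measureReal_nonneg, fun y => measureReal_le_one, ?_⟩
  · rw [hs]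
    exact continuous_const.sub (continuous_betaCDF ha)
  · rw [survival_symmBeta ha, betaCDF_zero, sub_zero]
  · intro y hy
    refine le_antisymm ?_ measureReal_nonneg
    have h1 := hanti hy
    rw [survival_symmBeta ha 1, betaCDF_one ha, sub_self] at h1
    exact h1

lemma betaCDF_lt_one {a : ℝ} (ha : 0 < a) {y : ℝ} (hy0 : 0 ≤ y) (hy : y < 1) :
    betaCDF a y < 1 := by
  have := strictMonoOn_betaCDF ha ⟨hy0, hy.le⟩ (Set.right_mem_Icc.2 zero_le_one) hy
  rwa [betaCDF_one ha] at this

/-- The symmetric Beta law has a strictly increasing generalized failure rate. -/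
lemma generalizedFailureRate_lt {a : ℝ} (ha : 0 < a) {x y : ℝ} (hx : 0 < x) (hxy : x < y)
    (hy : y < 1) :
    x * betaPDFReal a a x * (1 - betaCDF a y) < y * betaPDFReal a a y * (1 - betaCDF a x) := by
  have hy0 : 0 < y := hx.trans hxy
  have hx1 : x < 1 := hxy.trans hy
  have hfx := betaPDFReal_pos hx hx1 ha ha
  have hfy := betaPDFReal_pos hy0 hy ha ha
  have hGy : 0 < 1 - betaCDF a y := sub_pos.2 (betaCDF_lt_one ha hy0.le hy)
  have hFlt := strictMonoOn_betaCDF ha ⟨hx.le, hx1.le⟩ ⟨hy0.le, hy.le⟩ hxy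
  have hC := beta_pos ha ha
  rcases le_total a 1 with ha1 | ha1
  · have hN : ∀ t, 0 < t → t < 1 →
        t * betaPDFReal a a t = (beta a a)⁻¹ * (t ^ a * (1 - t) ^ (a - 1)) := by
      intro t h0 h1
      have : t ^ a = t * t ^ (a - 1) := by
        rw [← Real.rpow_one_add' h0.le (by linarith)]
        congr 1
        ring
      rw [betaPDFReal, if_pos ⟨h0, h1⟩, this]
      ring
    have h1 : x * betaPDFReal a a x < y * betaPDFReal a a y := by
      rw [hN x hx hx1, hN y hy0 hy]
      refine mul_lt_mul_of_pos_left ?_ (inv_pos.2 hC)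
      refine mul_lt_mul (Real.rpow_lt_rpow hx.le hxy ha) ?_
        (Real.rpow_pos_of_pos (sub_pos.2 hx1) _) (Real.rpow_nonneg hy0.le _)
      exact Real.rpow_le_rpow_of_nonpos (sub_pos.2 hy) (by linarith) (by linarith)
    calc _ ≤ y * betaPDFReal a a y * (1 - betaCDF a y) :=
          mul_le_mul_of_nonneg_right h1.le hGy.le
      _ < _ := mul_lt_mul_of_pos_left (by linarith) (mul_pos hy0 hfy)
  · set c := x / y with hc
    have hc0 : 0 < c := div_pos hx hy0
    have hc1 : c < 1 := (div_lt_one hy0).2 hxy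
    have hyc : y * c = x := mul_div_cancel₀ x hy0.ne'
    -- For `a ≥ 1`, scaling by `c = x / y` maps `[y, 1]` onto `[x, c]`. The pointwise comparison
    -- integrates to a bound by `betaCDF a c - betaCDF a x`, and `c < 1` makes it strict.
    have hpt : ∀ t ∈ Set.Icc y 1, x * betaPDFReal a a x * betaPDFReal a a t
        ≤ y * betaPDFReal a a y * c * betaPDFReal a a (t * c) := by
      intro t ht
      have hR : 0 ≤ y * betaPDFReal a a y * c * betaPDFReal a a (t * c) :=
        mul_nonneg (by positivity) (betaPDFReal_nonneg ha ha _)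
      rcases ht.2.eq_or_lt with rfl | ht1
      · rw [betaPDFReal, betaPDFReal, if_neg (c := 0 < (1 : ℝ) ∧ (1 : ℝ) < 1) (by simp), mul_zero]
        simpa [betaPDFReal] using hR
      have ht0 : 0 < t := hy0.trans_le ht.1
      have htc : t * c < 1 := by nlinarith
      rw [betaPDFReal_eq ⟨hx, hx1⟩, betaPDFReal_eq ⟨ht0, ht1⟩, betaPDFReal_eq ⟨hy0, hy⟩,
        betaPDFReal_eq ⟨mul_pos ht0 hc0, htc⟩]
      have e1 : 0 ≤ x * (1 - x) := mul_nonneg hx.le (sub_nonneg.2 hx1.le)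
      have e2 : 0 ≤ y * (1 - y) := mul_nonneg hy0.le (sub_nonneg.2 hy.le)
      have e3 : 0 ≤ t * (1 - t) := mul_nonneg ht0.le (sub_nonneg.2 ht1.le)
      have e4 : 0 ≤ t * c * (1 - t * c) :=
        mul_nonneg (mul_pos ht0 hc0).le (sub_nonneg.2 htc.le)
      have e5 : x * (1 - x) * (t * (1 - t)) ≤ y * (1 - y) * (t * c * (1 - t * c)) := by
        have h1 : (1 - x) * (1 - t) ≤ (1 - y) * (1 - t * c) := by
          have h2 := mul_nonneg (sub_nonneg.2 ht.1) (sub_nonneg.2 hc1.le)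
          have h3 : (1 - y) * (1 - t * c) - (1 - x) * (1 - t) = (t - y) * (1 - c) := by
            rw [← hyc]
            ring
          linarith
        calc x * (1 - x) * (t * (1 - t)) = x * t * ((1 - x) * (1 - t)) := by ring
          _ ≤ x * t * ((1 - y) * (1 - t * c)) :=
            mul_le_mul_of_nonneg_left h1 (mul_pos hx ht0).le
          _ = _ := by rw [← hyc]; ring
      have e6 := Real.rpow_le_rpow (mul_nonneg e1 e3) e5 (sub_nonneg.2 ha1)
      rw [Real.mul_rpow e1 e3, Real.mul_rpow e2 e4] at e6
      calc x * ((beta a a)⁻¹ * (x * (1 - x)) ^ (a - 1))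
            * ((beta a a)⁻¹ * (t * (1 - t)) ^ (a - 1))
          = x * (beta a a)⁻¹ ^ 2 * ((x * (1 - x)) ^ (a - 1) * (t * (1 - t)) ^ (a - 1)) := by ring
        _ ≤ x * (beta a a)⁻¹ ^ 2
            * ((y * (1 - y)) ^ (a - 1) * (t * c * (1 - t * c)) ^ (a - 1)) :=
          mul_le_mul_of_nonneg_left e6 (by positivity)
        _ = _ := by rw [← hyc]; ring
    have hint : IntervalIntegrable (fun t => betaPDFReal a a (t * c)) volume y 1 :=
      ((integrable_betaPDFReal ha ha).comp_mul_right' hc0.ne').intervalIntegrable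
    have h1 := intervalIntegral.integral_mono_on hy.le
      ((intervalIntegrable_betaPDFReal ha y 1).const_mul (x * betaPDFReal a a x))
      (hint.const_mul (y * betaPDFReal a a y * c)) hpt
    rw [intervalIntegral.integral_const_mul, intervalIntegral.integral_const_mul,
      intervalIntegral.integral_comp_mul_right _ hc0.ne', ← betaCDF_sub ha, ← betaCDF_sub ha,
      betaCDF_one ha, hyc, one_mul, smul_eq_mul, mul_assoc _ c, mul_inv_cancel_left₀ hc0.ne'] at h1
    have h2 := betaCDF_lt_one ha hc0.le hc1
    refine h1.trans_lt (mul_lt_mul_of_pos_left (by linarith) (mul_pos hy0 hfy))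

lemma hasDerivAt_mul_survival_rpow {a α : ℝ} (ha : 0 < a) {y : ℝ}
    (hy : y ∈ Set.Ioo (0 : ℝ) 1) :
    HasDerivAt (fun y => y * survival (symmBeta a) y ^ (1 + α))
      (survival (symmBeta a) y ^ α
        * (1 - betaCDF a y - (1 + α) * (y * betaPDFReal a a y))) y := by
  have hG : 0 < 1 - betaCDF a y := sub_pos.2 (betaCDF_lt_one ha hy.1.le hy.2)
  have hs : survival (symmBeta a) = fun y => 1 - betaCDF a y := funext (survival_symmBeta ha)
  rw [hs]
  have h1 := ((hasDerivAt_betaCDF ha hy).const_sub 1).rpow_const (p := 1 + α) (Or.inl hG.ne')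
  have h2 := (hasDerivAt_id y).mul h1
  refine h2.congr_deriv ?_
  simp only [id_eq, add_sub_cancel_left]
  rw [show (1 - betaCDF a y) ^ (1 + α) = (1 - betaCDF a y) * (1 - betaCDF a y) ^ α by
    rw [Real.rpow_add hG, Real.rpow_one]]
  ring

/-- The mode of `y * G y ^ (1 + α)` for a symmetric Beta law, and its position relative to the
mean. -/
theorem exists_hasPeak_symmBeta {a α : ℝ} (ha : 0 < a) (hα : 0 < α) :
    ∃ z, HasPeak α (survival (symmBeta a)) z ∧
      (1 / 2 < z ↔ (1 + α) * betaPDFReal a a (1 / 2) < 1) ∧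
      (1 / 2 ≤ z → (1 + α) * betaPDFReal a a (1 / 2) ≤ 1) := by
  have hG := isSurvival_symmBeta ha
  have hpos : ∀ y ∈ Set.Ioo (0 : ℝ) 1, 0 < survival (symmBeta a) y := fun y hy => by
    rw [survival_symmBeta ha]
    exact sub_pos.2 (betaCDF_lt_one ha hy.1.le hy.2)
  set D : ℝ → ℝ := fun y => 1 - betaCDF a y - (1 + α) * (y * betaPDFReal a a y) with hD
  have hderiv := fun y hy => hasDerivAt_mul_survival_rpow (a := a) (α := α) (y := y) ha hy
  have hcont : Continuous fun y => y * survival (symmBeta a) y ^ (1 + α) :=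
    continuous_id.mul (hG.continuous.rpow_const fun _ => Or.inr (by positivity))
  -- `D` carries the sign of the derivative. The increasing failure rate lets it change sign only
  -- once, from positive to negative, so its sign at `1/2` locates the mode.
  have hcross : ∀ x y, 0 < x → x < y → y < 1 → 0 ≤ D y → 0 < D x := by
    intro x y hx hxy hy h
    have h1 := generalizedFailureRate_lt ha hx hxy hy
    have hfx := betaPDFReal_pos hx (hxy.trans hy) ha ha
    have hfy := betaPDFReal_pos (hx.trans hxy) hy ha ha
    have h2 : x * betaPDFReal a a x * ((1 + α) * (y * betaPDFReal a a y))
        ≤ x * betaPDFReal a a x * (1 - betaCDF a y) :=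
      mul_le_mul_of_nonneg_left (by simp only [hD] at h; linarith) (mul_pos hx hfx).le
    have h3 : 0 < y * betaPDFReal a a y := mul_pos (hx.trans hxy) hfy
    have h4 : y * betaPDFReal a a y * ((1 + α) * (x * betaPDFReal a a x))
        < y * betaPDFReal a a y * (1 - betaCDF a x) := by linarith
    exact sub_pos.2 (lt_of_mul_lt_mul_left h4 h3.le)
  obtain ⟨z, hz, hmax⟩ := (isCompact_Icc (a := (0 : ℝ)) (b := 1)).exists_isMaxOn
    (Set.nonempty_Icc.2 zero_le_one) hcont.continuousOn
  have hzpos : 0 < z * survival (symmBeta a) z ^ (1 + α) := by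
    have h1 : (0 : ℝ) < 1 / 2 * survival (symmBeta a) (1 / 2) ^ (1 + α) :=
      mul_pos (by norm_num) (Real.rpow_pos_of_pos (hpos _ (by norm_num)) _)
    exact h1.trans_le (hmax (Set.mem_Icc.2 (by norm_num)))
  have hz0 : 0 < z := by
    refine lt_of_le_of_ne hz.1 ?_
    rintro rfl
    simp at hzpos
  have hz1 : z < 1 := by
    refine lt_of_le_of_ne hz.2 ?_
    rintro rfl
    rw [hG.eq_zero 1 le_rfl, Real.zero_rpow (by positivity)] at hzpos
    simp at hzpos
  have hDz : D z = 0 := by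
    have h1 : IsLocalMax (fun y => y * survival (symmBeta a) y ^ (1 + α)) z :=
      hmax.isLocalMax (Icc_mem_nhds hz0 hz1)
    have h2 := h1.hasDerivAt_eq_zero (hderiv z ⟨hz0, hz1⟩)
    exact (mul_eq_zero.1 h2).resolve_left (Real.rpow_pos_of_pos (hpos z ⟨hz0, hz1⟩) _).ne'
  have hDlt : ∀ y, 0 < y → y < z → 0 < D y := fun y h1 h2 => hcross y z h1 h2 hz1 hDz.ge
  have hDgt : ∀ y, z < y → y < 1 → D y < 0 := by
    intro y h1 h2
    by_contra! hc
    exact (hcross z y hz0 h1 h2 hc).ne' hDz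
  have hhalf : D (1 / 2) = (1 - (1 + α) * betaPDFReal a a (1 / 2)) / 2 := by
    simp only [hD]
    rw [betaCDF_half ha]
    ring
  refine ⟨z, ⟨hG, ?_, ⟨hz0, hz1⟩, ?_, ?_⟩, ?_, ?_⟩
  · intro x hx y hy hxy
    rw [survival_symmBeta ha, survival_symmBeta ha]
    exact sub_lt_sub_left (strictMonoOn_betaCDF ha hx hy hxy) 1
  · refine strictMonoOn_of_deriv_pos (convex_Icc 0 z) hcont.continuousOn fun y hy => ?_
    rw [interior_Icc] at hy
    have hy' : y ∈ Set.Ioo (0 : ℝ) 1 := ⟨hy.1, hy.2.trans hz1⟩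
    rw [(hderiv y hy').deriv]
    exact mul_pos (Real.rpow_pos_of_pos (hpos y hy') _) (hDlt y hy.1 hy.2)
  · refine strictAntiOn_of_deriv_neg (convex_Icc z 1) hcont.continuousOn fun y hy => ?_
    rw [interior_Icc] at hy
    have hy' : y ∈ Set.Ioo (0 : ℝ) 1 := ⟨hz0.trans hy.1, hy.2⟩
    rw [(hderiv y hy').deriv]
    exact mul_neg_of_pos_of_neg (Real.rpow_pos_of_pos (hpos y hy') _) (hDgt y hy.1 hy.2)
  · constructor
    · intro h
      have := hDlt (1 / 2) (by norm_num) h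
      linarith
    · intro h
      by_contra! hc
      have h1 : 0 < D (1 / 2) := by linarith
      rcases hc.eq_or_lt with hc | hc
      · rw [← hc, hDz] at h1
        exact lt_irrefl _ h1
      · exact (hDgt (1 / 2) hc (by norm_num)).not_gt h1
  · intro h
    rcases h.eq_or_lt with h | h
    · rw [← h] at hDz
      linarith
    · have := hDlt (1 / 2) (by norm_num) h
      linarith

/-! ### Comparison of symmetric Beta laws -/

/-- The likelihood ratio is a constant times `(t * (1 - t)) ^ (b - a)`, which increases on the right
of the mean. -/
lemma betaPDFReal_mul_lt {a b : ℝ} (hb : 0 < b) (hba : b < a) {x y : ℝ} (hx : 1 / 2 ≤ x)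
    (hxy : x < y) (hy : y < 1) :
    betaPDFReal b b x * betaPDFReal a a y < betaPDFReal b b y * betaPDFReal a a x := by
  have ha : 0 < a := hb.trans hba
  have hx0 : 0 < x := by linarith
  have hux : 0 < x * (1 - x) := mul_pos hx0 (by linarith)
  have huy : 0 < y * (1 - y) := mul_pos (hx0.trans hxy) (by linarith)
  have hlt : y * (1 - y) < x * (1 - x) := by nlinarith
  rw [betaPDFReal_eq ⟨hx0, hxy.trans hy⟩, betaPDFReal_eq ⟨hx0, hxy.trans hy⟩,
    betaPDFReal_eq ⟨hx0.trans hxy, hy⟩, betaPDFReal_eq ⟨hx0.trans hxy, hy⟩]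
  have hpow : ∀ u : ℝ, 0 < u → u ^ (a - 1) = u ^ (b - 1) * u ^ (a - b) := fun u hu => by
    rw [← Real.rpow_add hu]
    congr 1
    ring
  rw [hpow _ hux, hpow _ huy]
  have h1 := Real.rpow_lt_rpow huy.le hlt (sub_pos.2 hba)
  have h2 := Real.rpow_pos_of_pos hux (b - 1)
  have h3 := Real.rpow_pos_of_pos huy (b - 1)
  have h4 := inv_pos.2 (beta_pos ha ha)
  have h5 := inv_pos.2 (beta_pos hb hb)
  have h6 := mul_lt_mul_of_pos_left h1 (mul_pos (mul_pos h2 h3) (mul_pos h4 h5))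
  linarith

lemma integral_betaPDFReal_mono {a b x y p q : ℝ} (ha : 0 < a) (hb : 0 < b) (hxy : x ≤ y)
    (h : ∀ t ∈ Set.Icc x y, p * betaPDFReal b b t ≤ q * betaPDFReal a a t) :
    p * (betaCDF b y - betaCDF b x) ≤ q * (betaCDF a y - betaCDF a x) := by
  have := intervalIntegral.integral_mono_on hxy
    ((intervalIntegrable_betaPDFReal hb x y).const_mul p)
    ((intervalIntegrable_betaPDFReal ha x y).const_mul q) h
  rwa [intervalIntegral.integral_const_mul, intervalIntegral.integral_const_mul,
    ← betaCDF_sub ha, ← betaCDF_sub hb] at this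

lemma integral_betaPDFReal_lt {a b x y p q : ℝ} (ha : 0 < a) (hb : 0 < b) (hx : 0 < x)
    (hxy : x < y) (hy : y < 1)
    (h : ∀ t ∈ Set.Ico x y, p * betaPDFReal b b t < q * betaPDFReal a a t) :
    p * (betaCDF b y - betaCDF b x) < q * (betaCDF a y - betaCDF a x) := by
  have hder : ∀ t ∈ Set.Ioo x y, HasDerivAt (fun t => q * betaCDF a t - p * betaCDF b t)
      (q * betaPDFReal a a t - p * betaPDFReal b b t) t := fun t ht =>
    ((hasDerivAt_betaCDF ha ⟨hx.trans ht.1, ht.2.trans hy⟩).const_mul q).sub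
      ((hasDerivAt_betaCDF hb ⟨hx.trans ht.1, ht.2.trans hy⟩).const_mul p)
  have hmono : StrictMonoOn (fun t => q * betaCDF a t - p * betaCDF b t) (Set.Icc x y) := by
    refine strictMonoOn_of_deriv_pos (convex_Icc x y)
      ((continuous_const.mul (continuous_betaCDF ha)).sub
        (continuous_const.mul (continuous_betaCDF hb))).continuousOn fun t ht => ?_
    rw [interior_Icc] at ht
    rw [(hder t ht).deriv]
    exact sub_pos.2 (h t ⟨ht.1.le, ht.2⟩)
  have := hmono (Set.left_mem_Icc.2 hxy.le) (Set.right_mem_Icc.2 hxy.le) hxy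
  linarith

lemma betaPDFReal_one (a : ℝ) : betaPDFReal a a 1 = 0 := by
  rw [betaPDFReal, if_neg]
  simp

/-- The likelihood ratio is below its value at `z` on `[y, z)` and above it on `(z, 1)`; comparing
the masses of the two intervals gives the monotone ratio of survival functions. -/
lemma survival_mul_lt {a b : ℝ} (hb : 0 < b) (hba : b < a) {y z : ℝ} (hy : 1 / 2 ≤ y)
    (hyz : y < z) (hz : z < 1) :
    (1 - betaCDF b y) * (1 - betaCDF a z) < (1 - betaCDF b z) * (1 - betaCDF a y) := by
  have ha : 0 < a := hb.trans hba
  have hy0 : 0 < y := by linarith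
  have hz0 : 0 < z := hy0.trans hyz
  have hp := betaPDFReal_pos hz0 hz ha ha
  have h1 := integral_betaPDFReal_lt (p := betaPDFReal a a z) (q := betaPDFReal b b z) ha hb hy0
    hyz hz fun t ht => by
      have := betaPDFReal_mul_lt hb hba (hy.trans ht.1) ht.2 hz
      linarith
  have h2 := integral_betaPDFReal_mono (p := betaPDFReal b b z) (q := betaPDFReal a a z) hb ha
    hz.le fun t ht => by
      rcases ht.1.eq_or_lt with rfl | h1
      · rw [mul_comm]
      rcases ht.2.eq_or_lt with rfl | h2
      · rw [betaPDFReal_one, betaPDFReal_one, mul_zero, mul_zero]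
      · have := betaPDFReal_mul_lt hb hba (hy.trans hyz.le) h1 h2
        linarith
  rw [betaCDF_one ha, betaCDF_one hb] at h2
  have hA : 0 < betaCDF a z - betaCDF a y :=
    sub_pos.2 (strictMonoOn_betaCDF ha ⟨hy0.le, (hyz.trans hz).le⟩ ⟨hz0.le, hz.le⟩ hyz)
  have hB : 0 < 1 - betaCDF a z := sub_pos.2 (betaCDF_lt_one ha hz0.le hz)
  have h3 := mul_lt_mul_of_pos_right h1 hB
  have h4 := mul_le_mul_of_nonneg_right h2 hA.le
  have h5 : betaPDFReal a a z * ((betaCDF b z - betaCDF b y) * (1 - betaCDF a z))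
      < betaPDFReal a a z * ((betaCDF a z - betaCDF a y) * (1 - betaCDF b z)) := by linarith
  have h6 := lt_of_mul_lt_mul_left h5 hp.le
  linarith

lemma betaCDF_lt_of_half_lt {a b : ℝ} (hb : 0 < b) (hba : b < a) {z : ℝ} (hz : 1 / 2 < z)
    (hz1 : z < 1) : betaCDF b z < betaCDF a z := by
  have h := survival_mul_lt hb hba le_rfl hz hz1
  rw [betaCDF_half hb, betaCDF_half (hb.trans hba)] at h
  linarith

lemma betaCDF_lt_of_lt_half {a b : ℝ} (hb : 0 < b) (hba : b < a) {y : ℝ} (hy0 : 0 < y)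
    (hy : y < 1 / 2) : betaCDF a y < betaCDF b y := by
  have h := betaCDF_lt_of_half_lt hb hba (z := 1 - y) (by linarith) (by linarith)
  rw [betaCDF_symm hb, betaCDF_symm (hb.trans hba)] at h
  linarith

/-- Above the mean, the ratio of the survival functions of a more and a less dispersed law is
largest at the largest income. -/
lemma survival_ratio_le {a b : ℝ} (hb : 0 < b) (hba : b < a) {u z : ℝ} (hu : 0 ≤ u)
    (huz : u ≤ z) (hz : 1 / 2 ≤ z) (hz1 : z < 1) :
    (1 - betaCDF b u) * (1 - betaCDF a z) ≤ (1 - betaCDF b z) * (1 - betaCDF a u) := by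
  have ha : 0 < a := hb.trans hba
  have hz2 : betaCDF b z ≤ betaCDF a z := by
    rcases hz.eq_or_lt with rfl | hz
    · rw [betaCDF_half ha, betaCDF_half hb]
    · exact (betaCDF_lt_of_half_lt hb hba hz hz1).le
  rcases le_or_gt (1 / 2) u with h | h
  · rcases huz.eq_or_lt with rfl | huz
    · rw [mul_comm]
    · exact (survival_mul_lt hb hba h huz hz1).le
  · have h1 : betaCDF a u ≤ betaCDF b u := by
      rcases hu.eq_or_lt with rfl | hu
      · simp
      · exact (betaCDF_lt_of_lt_half hb hba hu h).le
    have h2 := betaCDF_lt_one ha (hu.trans huz) hz1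
    have h3 := betaCDF_lt_one ha hu (huz.trans_lt hz1)
    calc _ ≤ (1 - betaCDF a u) * (1 - betaCDF a z) :=
          mul_le_mul_of_nonneg_right (by linarith) (by linarith)
      _ = (1 - betaCDF a z) * (1 - betaCDF a u) := mul_comm _ _
      _ ≤ _ := mul_le_mul_of_nonneg_right (by linarith) (by linarith)

/-- Otherwise the monotone likelihood ratio would keep the density of `b` above that of `a` on
`[1/2, 3/4]`, against the order of the distribution functions at `3/4`. -/
lemma betaPDFReal_half_lt {a b : ℝ} (hb : 0 < b) (hba : b < a) :
    betaPDFReal b b (1 / 2) < betaPDFReal a a (1 / 2) := by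
  by_contra! hc
  have ha : 0 < a := hb.trans hba
  have h1 := integral_betaPDFReal_mono (p := 1) (q := 1) hb ha (x := 1 / 2) (y := 3 / 4)
    (by norm_num) fun t ht => by
      rw [one_mul, one_mul]
      rcases ht.1.eq_or_lt with rfl | h1
      · exact hc
      have ht1 : t < 1 := by linarith [ht.2]
      have h2 := betaPDFReal_mul_lt hb hba le_rfl h1 ht1
      have h3 := betaPDFReal_pos (by norm_num : (0 : ℝ) < 1 / 2) (by norm_num) ha ha
      have h4 := betaPDFReal_pos (by linarith : 0 < t) ht1 ha ha
      have h5 := mul_le_mul_of_nonneg_right hc h4.le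
      have h6 : betaPDFReal a a (1 / 2) * betaPDFReal a a t
          ≤ betaPDFReal a a (1 / 2) * betaPDFReal b b t := by linarith
      exact le_of_mul_le_mul_left h6 h3
  rw [betaCDF_half ha, betaCDF_half hb] at h1
  have h2 := betaCDF_lt_of_half_lt hb hba (z := 3 / 4) (by norm_num) (by norm_num)
  linarith

/-- A combination of three densities with signs `+`, `-`, `+` can change sign at most twice below
the mean. -/
lemma betaPDFReal_combination_neg {a b c r : ℝ} (hb : 0 < b) (hba : b < a) (hac : a < c)
    (hr : 0 < r) {x y z : ℝ} (hx : 0 < x) (hxy : x < y) (hyz : y < z) (hz : z < 1 / 2)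
    (h1 : betaPDFReal b b x - (1 + r) * betaPDFReal a a x + r * betaPDFReal c c x ≤ 0)
    (h2 : betaPDFReal b b z - (1 + r) * betaPDFReal a a z + r * betaPDFReal c c z ≤ 0) :
    betaPDFReal b b y - (1 + r) * betaPDFReal a a y + r * betaPDFReal c c y < 0 := by
  have hc : 0 < c := hb.trans (hba.trans hac)
  have hp : 0 < a - b := sub_pos.2 hba
  -- In the variable `v = (t * (1 - t)) ^ (a - b)`, increasing below the mean, the combination is a
  -- positive factor times `const - const * v + const * v ^ k` with `k > 1`. This is strictly
  -- convex, hence negative between two points where it is nonpositive.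
  set k := (c - b) / (a - b) with hk
  have hk1 : 1 < k := (one_lt_div hp).2 (by linarith)
  have hrep : ∀ t, 0 < t → t < 1 / 2 →
      betaPDFReal b b t - (1 + r) * betaPDFReal a a t + r * betaPDFReal c c t
        = (t * (1 - t)) ^ (b - 1) * ((beta b b)⁻¹
          - (1 + r) * (beta a a)⁻¹ * (t * (1 - t)) ^ (a - b)
          + r * (beta c c)⁻¹ * ((t * (1 - t)) ^ (a - b)) ^ k) := by
    intro t h0 ht
    have hu : 0 < t * (1 - t) := mul_pos h0 (by linarith)
    have e1 : (t * (1 - t)) ^ (a - 1) = (t * (1 - t)) ^ (b - 1) * (t * (1 - t)) ^ (a - b) := by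
      rw [← Real.rpow_add hu]
      congr 1
      ring
    have e2 : (t * (1 - t)) ^ (c - 1)
        = (t * (1 - t)) ^ (b - 1) * ((t * (1 - t)) ^ (a - b)) ^ k := by
      rw [← Real.rpow_mul hu.le, hk, mul_div_cancel₀ _ hp.ne', ← Real.rpow_add hu]
      congr 1
      ring
    rw [betaPDFReal_eq ⟨h0, by linarith⟩, betaPDFReal_eq ⟨h0, by linarith⟩,
      betaPDFReal_eq ⟨h0, by linarith⟩, e1, e2]
    ring
  have hy0 := hx.trans hxy
  have hz0 := hy0.trans hyz
  have hupos : ∀ t : ℝ, 0 < t → t < 1 / 2 → 0 < t * (1 - t) :=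
    fun t h0 h1 => mul_pos h0 (by linarith)
  have hvmono : ∀ s t : ℝ, 0 < s → s < t → t < 1 / 2 →
      (s * (1 - s)) ^ (a - b) < (t * (1 - t)) ^ (a - b) := fun s t h0 h1 h2 =>
    Real.rpow_lt_rpow (hupos s h0 (h1.trans h2)).le (by nlinarith) hp
  have hux := hupos x hx (hxy.trans (hyz.trans hz))
  have huy := hupos y hy0 (hyz.trans hz)
  have huz := hupos z hz0 hz
  rw [hrep x hx (hxy.trans (hyz.trans hz))] at h1
  rw [hrep z hz0 hz] at h2
  rw [hrep y hy0 (hyz.trans hz)]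
  have h1' := nonpos_of_mul_nonpos_right h1 (Real.rpow_pos_of_pos hux _)
  have h2' := nonpos_of_mul_nonpos_right h2 (Real.rpow_pos_of_pos huz _)
  refine mul_neg_of_pos_of_neg (Real.rpow_pos_of_pos huy _) ?_
  have v1 := hvmono x y hx hxy (hyz.trans hz)
  have v2 := hvmono y z hy0 hyz hz
  set vx := (x * (1 - x)) ^ (a - b)
  set vy := (y * (1 - y)) ^ (a - b)
  set vz := (z * (1 - z)) ^ (a - b)
  have hvx : 0 ≤ vx := Real.rpow_nonneg hux.le _
  have hvz : 0 ≤ vz := hvx.trans (v1.trans v2).le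
  have hlt : vx < vz := v1.trans v2
  obtain ⟨s, s', hs, hs', hss, hvy⟩ : ∃ s s' : ℝ, 0 < s ∧ 0 < s' ∧ s + s' = 1 ∧
      s * vx + s' * vz = vy := by
    have hne := (sub_pos.2 hlt).ne'
    refine ⟨(vz - vy) / (vz - vx), (vy - vx) / (vz - vx), div_pos (sub_pos.2 v2) (sub_pos.2 hlt),
      div_pos (sub_pos.2 v1) (sub_pos.2 hlt), ?_, ?_⟩
    · field_simp
      ring
    · field_simp
      ring
  have hconv := (strictConvexOn_rpow hk1).2 (Set.mem_Ici.2 hvx) (Set.mem_Ici.2 hvz) hlt.ne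
    hs hs' hss
  simp only [smul_eq_mul] at hconv
  have hCc : 0 < r * (beta c c)⁻¹ := mul_pos hr (inv_pos.2 (beta_pos hc hc))
  have g1 := mul_lt_mul_of_pos_left hconv hCc
  have g2 := mul_nonpos_of_nonneg_of_nonpos hs.le h1'
  have g3 := mul_nonpos_of_nonneg_of_nonpos hs'.le h2'
  have g4 : (beta b b)⁻¹ = s * (beta b b)⁻¹ + s' * (beta b b)⁻¹ := by
    rw [← add_mul, hss, one_mul]
  rw [← hvy]
  rw [g4]
  linarith

/-- The distribution functions of three symmetric Beta laws: their combination with signs `+`,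
`-`, `+` that vanishes at `w` is nonnegative below `w` and negative between `w` and the mean. -/
lemma exists_betaCDF_combination {a b c : ℝ} (hb : 0 < b) (hba : b < a) (hac : a < c) {w : ℝ}
    (hw0 : 0 < w) (hw : w < 1 / 2) :
    ∃ r, 0 < r ∧ (∀ y ∈ Set.Ioo 0 w,
        0 ≤ betaCDF b y - (1 + r) * betaCDF a y + r * betaCDF c y) ∧
      ∀ y ∈ Set.Ioo w (1 / 2), betaCDF b y - (1 + r) * betaCDF a y + r * betaCDF c y < 0 := by
  have ha : 0 < a := hb.trans hba
  have hc : 0 < c := ha.trans hac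
  have hΔ := betaCDF_lt_of_lt_half hb hba hw0 hw
  have hΔ' := betaCDF_lt_of_lt_half ha hac hw0 hw
  -- This `r` makes the combination vanish at `w`; it also vanishes at `0` and, by symmetry, at
  -- `1/2`. A wrong sign on either side of `w` would give, by the mean value theorem, three
  -- derivative signs excluded by `hneg`.
  set r := (betaCDF b w - betaCDF a w) / (betaCDF a w - betaCDF c w) with hr
  have hr0 : 0 < r := div_pos (sub_pos.2 hΔ) (sub_pos.2 hΔ')
  set h : ℝ → ℝ := fun y => betaCDF b y - (1 + r) * betaCDF a y + r * betaCDF c y with hh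
  set h' : ℝ → ℝ := fun y =>
    betaPDFReal b b y - (1 + r) * betaPDFReal a a y + r * betaPDFReal c c y with hh'
  have hcont : Continuous h := ((continuous_betaCDF hb).sub
    (continuous_const.mul (continuous_betaCDF ha))).add
      (continuous_const.mul (continuous_betaCDF hc))
  have hder : ∀ y ∈ Set.Ioo (0 : ℝ) 1, HasDerivAt h (h' y) y := fun y hy =>
    ((hasDerivAt_betaCDF hb hy).sub ((hasDerivAt_betaCDF ha hy).const_mul _)).add
      ((hasDerivAt_betaCDF hc hy).const_mul _)
  have hmvt : ∀ s t : ℝ, 0 ≤ s → s < t → t ≤ 1 / 2 → ∃ x, s < x ∧ x < t ∧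
      (h t ≤ h s → h' x ≤ 0) ∧ (h s ≤ h t → 0 ≤ h' x) ∧ (h s < h t → 0 < h' x) := by
    intro s t h0 hst ht
    obtain ⟨x, hx, he⟩ := exists_hasDerivAt_eq_slope h h' hst hcont.continuousOn
      fun x hx => hder x ⟨h0.trans_lt hx.1, hx.2.trans (by linarith)⟩
    have hts := sub_pos.2 hst
    refine ⟨x, hx.1, hx.2, fun h1 => ?_, fun h1 => ?_, fun h1 => ?_⟩
    · rw [he]
      exact div_nonpos_of_nonpos_of_nonneg (sub_nonpos.2 h1) hts.le
    · rw [he]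
      exact div_nonneg (sub_nonneg.2 h1) hts.le
    · rw [he]
      exact div_pos (sub_pos.2 h1) hts
  have hneg : ∀ {x y z : ℝ}, 0 < x → x < y → y < z → z < 1 / 2 → h' x ≤ 0 → h' z ≤ 0 → h' y < 0 :=
    fun hx hxy hyz hz h1 h2 => betaPDFReal_combination_neg hb hba hac hr0 hx hxy hyz hz h1 h2
  have h_zero : h 0 = 0 := by simp [hh]
  have h_half : h (1 / 2) = 0 := by
    simp only [hh]
    rw [betaCDF_half ha, betaCDF_half hb, betaCDF_half hc]
    ring
  have h_w : h w = 0 := by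
    have := (sub_pos.2 hΔ').ne'
    have e : r * (betaCDF a w - betaCDF c w) = betaCDF b w - betaCDF a w := by
      rw [hr, div_mul_cancel₀ _ this]
    simp only [hh]
    linarith
  refine ⟨r, hr0, ?_, ?_⟩
  · intro y hy
    by_contra! hyneg
    change h y < 0 at hyneg
    obtain ⟨x₁, h01, h1y, e1⟩ := hmvt 0 y le_rfl hy.1 (hy.2.trans hw).le
    obtain ⟨x₂, hy2, h2w, e2⟩ := hmvt y w hy.1.le hy.2 hw.le
    obtain ⟨x₃, hw3, h3, e3⟩ := hmvt w (1 / 2) hw0.le hw le_rfl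
    have i1 := e1.1 (hyneg.le.trans h_zero.ge)
    have i2 := e2.2.2 (hyneg.trans_le h_w.ge)
    have i3 := e3.1 (h_half.trans h_w.symm).le
    exact (hneg h01 (h1y.trans hy2) (h2w.trans hw3) h3 i1 i3).not_gt i2
  · intro y hy
    by_contra! hypos
    change 0 ≤ h y at hypos
    obtain ⟨x₁, h01, h1w, e1⟩ := hmvt 0 w le_rfl hw0 hw.le
    obtain ⟨x₂, hw2, h2y, e2⟩ := hmvt w y hw0.le hy.1 hy.2.le
    obtain ⟨x₃, hy3, h3, e3⟩ := hmvt y (1 / 2) (hw0.trans hy.1).le hy.2 le_rfl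
    have i1 := e1.1 (h_w.trans h_zero.symm).le
    have i2 := e2.2.1 (h_w.le.trans hypos)
    have i3 := e3.1 (h_half.le.trans hypos)
    exact (hneg h01 (h1w.trans hw2) (h2y.trans hy3) h3 i1 i3).not_ge i2

/-! ### Continuity in the parameter and extreme dispersions -/

lemma continuousAt_beta_self {a : ℝ} (ha : 0 < a) : ContinuousAt (fun a => beta a a) a := by
  have h : ∀ s : ℝ, 0 < s → ContinuousAt Real.Gamma s := fun s hs =>
    (Real.differentiableAt_Gamma fun m => by
      have : (0 : ℝ) ≤ m := m.cast_nonneg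
      linarith).continuousAt
  have h2 : ContinuousAt (fun a : ℝ => Real.Gamma (a + a)) a :=
    ContinuousAt.comp (f := fun a : ℝ => a + a) (h (a + a) (by positivity)) (by fun_prop)
  exact ((h a ha).mul (h a ha)).div h2 (Real.Gamma_pos_of_pos (by positivity)).ne'

lemma betaPDFReal_eq_ite (a x : ℝ) : betaPDFReal a a x
    = (beta a a)⁻¹ * if x ∈ Set.Ioo (0 : ℝ) 1 then (x * (1 - x)) ^ (a - 1) else 0 := by
  split_ifs with h
  · exact betaPDFReal_eq h
  · rw [betaPDFReal, if_neg (fun h' => h (Set.mem_Ioo.2 h')), mul_zero]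

lemma continuousAt_betaCDF_param {a : ℝ} (ha : 0 < a) (y : ℝ) :
    ContinuousAt (fun a => betaCDF a y) a := by
  set k : ℝ → ℝ → ℝ := fun a x =>
    if x ∈ Set.Ioo (0 : ℝ) 1 then (x * (1 - x)) ^ (a - 1) else 0 with hk
  have hrep : ∀ a, betaCDF a y = (beta a a)⁻¹ * ∫ x in (0 : ℝ)..y, k a x := by
    intro a
    rw [betaCDF, ← intervalIntegral.integral_const_mul]
    simp only [betaPDFReal_eq_ite, hk]
  have hkb : ∀ b, 0 < b → ∀ x, k b x = beta b b * betaPDFReal b b x := fun b hb x => by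
    rw [betaPDFReal_eq_ite, mul_inv_cancel_left₀ (beta_pos hb hb).ne']
  simp only [hrep]
  refine ((continuousAt_beta_self ha).inv₀ (beta_pos ha ha).ne').mul ?_
  -- Since `x * (1 - x) ≤ 1`, the unnormalized density at `a / 2` dominates all those with a larger
  -- parameter, and it is still integrable.
  have hev : ∀ᶠ b in nhds a, a / 2 < b := lt_mem_nhds (by linarith)
  refine intervalIntegral.continuousAt_of_dominated_interval (bound := k (a / 2)) ?_ ?_ ?_ ?_
  · filter_upwards [hev] with b hb
    have hb0 : 0 < b := by linarith
    rw [show k b = fun x => beta b b * betaPDFReal b b x from funext (hkb b hb0)]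
    exact ((measurable_betaPDFReal b b).const_mul _).aestronglyMeasurable
  · filter_upwards [hev] with b hb
    refine Filter.Eventually.of_forall fun x _ => ?_
    simp only [hk]
    split_ifs with h
    · have hu : 0 < x * (1 - x) := mul_pos h.1 (sub_pos.2 h.2)
      rw [Real.norm_of_nonneg (Real.rpow_nonneg hu.le _)]
      refine Real.rpow_le_rpow_of_exponent_ge hu ?_ (by linarith)
      nlinarith [sq_nonneg (x - 1 / 2)]
    · simp
  · rw [show k (a / 2) = fun x => beta (a / 2) (a / 2) * betaPDFReal (a / 2) (a / 2) x from
      funext (hkb _ (by positivity))]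
    exact (intervalIntegrable_betaPDFReal (by positivity) _ _).const_mul _
  · refine Filter.Eventually.of_forall fun x _ => ?_
    simp only [hk]
    split_ifs with h
    · have hu : 0 < x * (1 - x) := mul_pos h.1 (sub_pos.2 h.2)
      exact ContinuousAt.rpow continuousAt_const (by fun_prop) (Or.inl hu.ne')
    · exact continuousAt_const

/-- For a very dispersed law, the density at the mean is small. -/
lemma betaPDFReal_quarter_half_lt : betaPDFReal (1 / 4) (1 / 4) (1 / 2) < 1 / 2 := by
  have ha : (0 : ℝ) < 1 / 4 := by norm_num
  have hC := inv_pos.2 (beta_pos ha ha)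
  have h1 := intervalIntegral.integral_mono_on_of_le_Ioo (a := 0) (b := 1 / 2)
    (f := fun x : ℝ => (beta (1 / 4) (1 / 4))⁻¹ * x ^ ((1 : ℝ) / 4 - 1)) (by norm_num)
    ((intervalIntegral.intervalIntegrable_rpow' (by norm_num)).const_mul _)
    (intervalIntegrable_betaPDFReal ha 0 (1 / 2)) (fun x hx => by
      have hx1 : x < 1 := by linarith [hx.2]
      rw [betaPDFReal_eq ⟨hx.1, hx1⟩, Real.mul_rpow hx.1.le (sub_nonneg.2 hx1.le)]
      have h2 : 1 ≤ (1 - x) ^ ((1 : ℝ) / 4 - 1) :=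
        Real.one_le_rpow_of_pos_of_le_one_of_nonpos (sub_pos.2 hx1) (by linarith [hx.1])
          (by norm_num)
      have h3 := Real.rpow_pos_of_pos hx.1 ((1 : ℝ) / 4 - 1)
      refine mul_le_mul_of_nonneg_left ?_ hC.le
      exact le_mul_of_one_le_right h3.le h2)
  change _ ≤ betaCDF (1 / 4) (1 / 2) at h1
  rw [betaCDF_half ha, intervalIntegral.integral_const_mul, integral_rpow (Or.inl (by norm_num)),
    sub_add_cancel, Real.zero_rpow ha.ne', sub_zero] at h1
  rw [betaPDFReal_eq ⟨by norm_num, by norm_num⟩]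
  have h2 : ((1 : ℝ) / 2 * (1 - 1 / 2)) ^ ((1 : ℝ) / 4 - 1)
      = 4 * ((1 / 2) ^ ((1 : ℝ) / 4) * (1 / 2) ^ ((1 : ℝ) / 4)) := by
    rw [Real.rpow_sub_one (by norm_num), ← Real.mul_rpow (by norm_num) (by norm_num)]
    norm_num
    ring
  have h3 : ((1 : ℝ) / 2) ^ ((1 : ℝ) / 4) < 1 :=
    Real.rpow_lt_one (by norm_num) (by norm_num) ha
  have h4 : 0 < ((1 : ℝ) / 2) ^ ((1 : ℝ) / 4) := Real.rpow_pos_of_pos (by norm_num) _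
  rw [h2]
  -- The mass `1/2` of the lower half is at least the integral of `x ^ (-3/4)` over it, which bounds
  -- the normalizing constant.
  have h5 : (beta (1 / 4) (1 / 4))⁻¹ * ((1 / 2 : ℝ) ^ ((1 : ℝ) / 4)) ≤ 1 / 8 := by linarith
  have h6 : 0 < (beta (1 / 4) (1 / 4))⁻¹ * ((1 / 2 : ℝ) ^ ((1 : ℝ) / 4)) := mul_pos hC h4
  nlinarith

lemma betaCDF_le_of_lt_half {a y : ℝ} (ha : 0 < a) (hy : y < 1 / 2) :
    betaCDF a y ≤ 1 / (4 * (2 * a + 1)) / (1 / 2 - y) ^ 2 := by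
  have := isProbabilityMeasure_symmBeta ha
  have h1 := meas_ge_le_variance_div_sq (memLp_id_symmBeta ha) (sub_pos.2 hy)
  have hv := incomeVar_eq ha
  rw [incomeVar] at hv
  simp only [id_eq] at h1
  rw [integral_symmBeta_id ha, hv] at h1
  have h2 : betaCDF a y = (symmBeta a).real (Set.Iio y) := by
    have h3 := survival_symmBeta ha y
    rw [survival, ← Set.compl_Iio, probReal_compl_eq_one_sub measurableSet_Iio] at h3
    linarith
  have h4 : (symmBeta a).real (Set.Iio y)
      ≤ (symmBeta a).real {x | 1 / 2 - y ≤ |x - 1 / 2|} := by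
    refine measureReal_mono fun x hx => ?_
    have hx' : x < y := hx
    change 1 / 2 - y ≤ |x - 1 / 2|
    rw [abs_sub_comm]
    exact le_trans (by linarith) (le_abs_self _)
  rw [h2]
  refine h4.trans (ENNReal.toReal_le_of_le_ofReal ?_ h1)
  have := sub_pos.2 hy
  positivity

lemma tendsto_survival_symmBeta {y : ℝ} (hy : y < 1 / 2) :
    Filter.Tendsto (fun a => survival (symmBeta a) y) Filter.atTop (nhds 1) := by
  have h1 : Filter.Tendsto (fun a : ℝ => 1 - 1 / (4 * (2 * a + 1)) / (1 / 2 - y) ^ 2)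
      Filter.atTop (nhds (1 - 0 / (1 / 2 - y) ^ 2)) := by
    refine tendsto_const_nhds.sub (Filter.Tendsto.div_const ?_ _)
    refine Filter.Tendsto.const_div_atTop ?_ 1
    refine Filter.Tendsto.const_mul_atTop (by norm_num) ?_
    exact Filter.tendsto_atTop_add_const_right _ _
      (Filter.Tendsto.const_mul_atTop (by norm_num) Filter.tendsto_id)
  rw [zero_div, sub_zero] at h1
  refine tendsto_of_tendsto_of_tendsto_of_le_of_le' h1 tendsto_const_nhds ?_ ?_
  · filter_upwards [Filter.eventually_gt_atTop 0] with a ha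
    rw [survival_symmBeta ha]
    exact sub_le_sub_left (betaCDF_le_of_lt_half ha hy) 1
  · filter_upwards [Filter.eventually_gt_atTop 0] with a ha
    exact (isSurvival_symmBeta ha).le_one y

/-- The envelope is `T m = E[θ; θ ≥ m]`, which dominates `m * G m` and equals the mean at `0`. -/
lemma StationaryLoan.optValue_symmBeta_le {ρ α δ K : ℝ} (hS : StationaryLoan ρ α δ K) {a : ℝ}
    (ha : 0 < a) : optValue ρ α (survival (symmBeta a)) 0 ≤ K / 2 := by
  have := isProbabilityMeasure_symmBeta ha
  have hint := integrable_id_symmBeta ha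
  have hG := isSurvival_symmBeta ha
  have h0 : ∫ x in Set.Ici (0 : ℝ), x ∂symmBeta a = 1 / 2 := by
    rw [← integral_symmBeta_id ha]
    have hae : ∀ᵐ x ∂symmBeta a, x ∈ Set.Ici (0 : ℝ) := by
      have h1 := hG.zero
      rw [survival, measureReal_def, ENNReal.toReal_eq_one_iff] at h1
      exact (mem_ae_iff_prob_eq_one measurableSet_Ici).2 h1
    rw [Measure.restrict_eq_self_of_ae_mem hae]
  have h := hS.optValue_zero_le (T := fun m => ∫ x in Set.Ici m, x ∂symmBeta a) hG ?_ ?_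
  · rw [h0] at h
    linarith
  · intro x hx y _ hxy
    refine setIntegral_mono_set hint.integrableOn ?_ (Set.Ici_subset_Ici.2 hxy).eventuallyLE
    refine (ae_restrict_iff' measurableSet_Ici).2 (Filter.Eventually.of_forall fun t ht => ?_)
    exact le_trans hx ht
  · intro y _
    have h1 := setIntegral_mono_on (μ := symmBeta a) (s := Set.Ici y) (f := fun _ => y)
      (g := fun x => x) (integrableOn_const (measure_ne_top _ _)) hint.integrableOn
      measurableSet_Ici fun x hx => hx
    rw [setIntegral_const, smul_eq_mul, mul_comm] at h1
    exact h1


/-! ### Optimal value as a function of the dispersion of income -/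

lemma screeningCost_le {L : List (ℝ × ℝ)} {F H : ℝ → ℝ}
    (h : ∀ p ∈ L, p.1 * F p.2 ≤ p.1 * H p.2) : screeningCost L F ≤ screeningCost L H :=
  List.sum_le_sum h

lemma screeningCost_const_mul (c : ℝ) (L : List (ℝ × ℝ)) (F : ℝ → ℝ) :
    screeningCost L (fun u => c * F u) = c * screeningCost L F := by
  induction L with
  | nil => simp
  | cons p L ih => rw [screeningCost_cons, screeningCost_cons, ih]; ring

lemma screeningCost_combination (r s : ℝ) (L : List (ℝ × ℝ)) (F H J : ℝ → ℝ) :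
    screeningCost L (fun u => F u - s * H u + r * J u)
      = screeningCost L F - s * screeningCost L H + r * screeningCost L J := by
  induction L with
  | nil => simp
  | cons p L ih => simp only [screeningCost_cons, ih]; ring

lemma continuousAt_screeningCost (L : List (ℝ × ℝ)) {a : ℝ} (ha : 0 < a) :
    ContinuousAt (fun c => screeningCost L fun u => 1 - betaCDF c u) a := by
  induction L with
  | nil => exact continuousAt_const
  | cons p L ih =>
    simp only [screeningCost_cons]
    exact (continuousAt_const.mul
      (continuousAt_const.sub (continuousAt_betaCDF_param ha p.2))).add ih

namespace StationaryLoan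

variable {ρ α δ K : ℝ}

lemma exists_plan_symmBeta (hS : StationaryLoan ρ α δ K) {a z : ℝ} (ha : 0 < a)
    (h : HasPeak α (survival (symmBeta a)) z) :
    ∃ m₁ e L P, 0 < m₁ ∧ m₁ < z ∧ 0 ≤ e ∧ 0 < P ∧ (∀ p ∈ L, 0 ≤ p.1 ∧ 0 < p.2 ∧ p.2 < m₁) ∧
      optValue ρ α (survival (symmBeta a)) 0
        = -e - screeningCost L (fun u => 1 - betaCDF a u) + P * (1 - betaCDF a z) ∧
      ∀ b, 0 < b → -e - screeningCost L (fun u => 1 - betaCDF b u) + P * (1 - betaCDF b z)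
        ≤ optValue ρ α (survival (symmBeta b)) 0 := by
  obtain ⟨m₁, e, L, P, h1, h2, h3, h4, h5, h6, h7⟩ := hS.exists_plan h
  have hs : ∀ b, 0 < b → survival (symmBeta b) = fun y => 1 - betaCDF b y :=
    fun b hb => funext (survival_symmBeta hb)
  refine ⟨m₁, e, L, P, h1, h2, h3, h4, h5, ?_, fun b hb => ?_⟩
  · rwa [hs a ha] at h6 ⊢
  · have := h7 _ (isSurvival_symmBeta hb)
    rwa [hs b hb] at this ⊢

/-- If the best repayment amount exceeds the mean income, then the lender gains from a more
dispersed income. -/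
lemma optValue_le_of_half_le (hS : StationaryLoan ρ α δ K) {a b z : ℝ} (hb : 0 < b)
    (hba : b < a) (h : HasPeak α (survival (symmBeta a)) z) (hz : 1 / 2 ≤ z) :
    optValue ρ α (survival (symmBeta a)) 0 ≤ optValue ρ α (survival (symmBeta b)) 0 ∧
      (1 / 2 < z →
        optValue ρ α (survival (symmBeta a)) 0 < optValue ρ α (survival (symmBeta b)) 0) := by
  have ha : 0 < a := hb.trans hba
  have hz1 := h.peak_mem.2
  have hpos := hS.optValue_pos h le_rfl zero_lt_one
  obtain ⟨m₁, e, L, P, -, hmz, he, -, hL, hVa, hV⟩ := hS.exists_plan_symmBeta ha h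
  have hVb := hV b hb
  set Va := optValue ρ α (survival (symmBeta a)) 0
  set Vb := optValue ρ α (survival (symmBeta b)) 0
  have hGa : 0 < 1 - betaCDF a z := sub_pos.2 (betaCDF_lt_one ha h.peak_mem.1.le hz1)
  have hcost : (1 - betaCDF a z) * screeningCost L (fun u => 1 - betaCDF b u)
      ≤ (1 - betaCDF b z) * screeningCost L (fun u => 1 - betaCDF a u) := by
    rw [← screeningCost_const_mul, ← screeningCost_const_mul]
    refine screeningCost_le fun p hp => mul_le_mul_of_nonneg_left ?_ (hL p hp).1
    rw [mul_comm]
    exact survival_ratio_le hb hba (hL p hp).2.1.le ((hL p hp).2.2.trans hmz).le hz hz1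
  -- Apart from the first outlay `e`, passing from `a` to `b` scales the plan's value by at least
  -- the ratio of the survival functions at `z`.
  have hkey : (1 - betaCDF b z) * (Va + e) ≤ (1 - betaCDF a z) * (Vb + e) := by
    have h1 := mul_le_mul_of_nonneg_left hVb hGa.le
    rw [hVa]
    linarith
  have hVe : 0 < Va + e := by linarith
  constructor
  · have h1 : betaCDF b z ≤ betaCDF a z := by
      rcases hz.eq_or_lt with rfl | hz
      · rw [betaCDF_half ha, betaCDF_half hb]
      · exact (betaCDF_lt_of_half_lt hb hba hz hz1).le
    have h2 : (1 - betaCDF a z) * (Va + e) ≤ (1 - betaCDF b z) * (Va + e) :=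
      mul_le_mul_of_nonneg_right (by linarith) hVe.le
    have h3 := le_of_mul_le_mul_left (h2.trans hkey) hGa
    linarith
  · intro hz
    have h1 := betaCDF_lt_of_half_lt hb hba hz hz1
    have h2 : (1 - betaCDF a z) * (Va + e) < (1 - betaCDF b z) * (Va + e) :=
      mul_lt_mul_of_pos_right (by linarith) hVe
    have h3 := lt_of_mul_lt_mul_left (h2.trans_le hkey) hGa.le
    linarith

/-- When the mode is exactly `1/2` one comparison gives only `≤`. An intermediate parameter has a
smaller density at `1/2`, hence a mode strictly above it, and supplies the strictness. -/
lemma optValue_lt_of_half_le (hS : StationaryLoan ρ α δ K) {a b z : ℝ} (hb : 0 < b)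
    (hba : b < a) (h : HasPeak α (survival (symmBeta a)) z)
    (hz : (1 + α) * betaPDFReal a a (1 / 2) ≤ 1) (hz' : 1 / 2 ≤ z) :
    optValue ρ α (survival (symmBeta a)) 0 < optValue ρ α (survival (symmBeta b)) 0 := by
  obtain ⟨c, hbc, hca⟩ := exists_between hba
  have hc := hb.trans hbc
  obtain ⟨z', hz2, hiff, -⟩ := exists_hasPeak_symmBeta hc hS.alpha_pos
  have h1 : 1 / 2 < z' := by
    refine hiff.2 (lt_of_lt_of_le ?_ hz)
    have := hS.alpha_pos
    exact mul_lt_mul_of_pos_left (betaPDFReal_half_lt hc hca) (by positivity)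
  exact (hS.optValue_le_of_half_le hc hca h hz').1.trans_lt
    ((hS.optValue_le_of_half_le hb hbc hz2 h1.le).2 h1)

/-- If the best repayment amount is below the mean income, then the optimal value is at most that
for a more dispersed or that for a less dispersed income. -/
lemma optValue_lt_or_lt_of_lt_half (hS : StationaryLoan ρ α δ K) {a b c z : ℝ} (hb : 0 < b)
    (hba : b < a) (hac : a < c) (h : HasPeak α (survival (symmBeta a)) z) (hz : z < 1 / 2) :
    optValue ρ α (survival (symmBeta a)) 0 < optValue ρ α (survival (symmBeta b)) 0 ∨
      optValue ρ α (survival (symmBeta a)) 0 < optValue ρ α (survival (symmBeta c)) 0 := by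
  have ha : 0 < a := hb.trans hba
  obtain ⟨m₁, e, L, P, hm0, hmz, -, hP, hL, hVa, hV⟩ := hS.exists_plan_symmBeta ha h
  have hVb := hV b hb
  have hVc := hV c (ha.trans hac)
  set Va := optValue ρ α (survival (symmBeta a)) 0
  set Vb := optValue ρ α (survival (symmBeta b)) 0
  set Vc := optValue ρ α (survival (symmBeta c)) 0
  -- The combination is made to vanish at `m₁`, which separates all screening amounts from `z`. The
  -- outlay `e` cancels because the coefficients `1`, `-(1 + r)`, `r` sum to zero.
  obtain ⟨r, hr, h1, h2⟩ := exists_betaCDF_combination hb hba hac hm0 (hmz.trans hz)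
  have hcost : screeningCost L (fun u => (1 - betaCDF b u) - (1 + r) * (1 - betaCDF a u)
      + r * (1 - betaCDF c u)) ≤ 0 := by
    have : screeningCost L (fun _ => (0 : ℝ)) = 0 := by
      have := screeningCost_const_mul 0 L fun _ => (0 : ℝ)
      simpa using this
    rw [← this]
    refine screeningCost_le fun p hp => mul_le_mul_of_nonneg_left ?_ (hL p hp).1
    have := h1 p.2 (hL p hp).2
    linarith
  rw [screeningCost_combination] at hcost
  have h3 := mul_pos_of_neg_of_neg (h2 z ⟨hmz, hz⟩) (neg_lt_zero.2 hP)
  by_contra! hcon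
  have h4 := mul_le_mul_of_nonneg_left hcon.2 hr.le
  have h5 := mul_le_mul_of_nonneg_left hVc hr.le
  have h6 : (1 + r) * Va = (1 + r) * (-e - screeningCost L (fun u => 1 - betaCDF a u)
      + P * (1 - betaCDF a z)) := by rw [hVa]
  linarith [hcon.1]

lemma optValue_lt_or_lt (hS : StationaryLoan ρ α δ K) {a b c : ℝ} (hb : 0 < b)
    (hba : b < a) (hac : a < c) :
    optValue ρ α (survival (symmBeta a)) 0 < optValue ρ α (survival (symmBeta b)) 0 ∨
      optValue ρ α (survival (symmBeta a)) 0 < optValue ρ α (survival (symmBeta c)) 0 := by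
  obtain ⟨z, h, -, hz⟩ := exists_hasPeak_symmBeta (hb.trans hba) hS.alpha_pos
  rcases le_or_gt (1 / 2) z with hz' | hz'
  · exact Or.inl (hS.optValue_lt_of_half_le hb hba h (hz hz') hz')
  · exact hS.optValue_lt_or_lt_of_lt_half hb hba hac h hz'

/-- The plan that is optimal at `a` stays feasible nearby, and its value is a finite combination of
distribution functions continuous in the parameter. -/
lemma eventually_lt_optValue (hS : StationaryLoan ρ α δ K) {a v : ℝ} (ha : 0 < a)
    (hv : v < optValue ρ α (survival (symmBeta a)) 0) :
    ∀ᶠ c in nhds a, v < optValue ρ α (survival (symmBeta c)) 0 := by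
  obtain ⟨z, h, -⟩ := exists_hasPeak_symmBeta ha hS.alpha_pos
  obtain ⟨m₁, e, L, P, -, -, -, -, -, hVa, hV⟩ := hS.exists_plan_symmBeta ha h
  have hc : ContinuousAt (fun c => -e - screeningCost L (fun u => 1 - betaCDF c u)
      + P * (1 - betaCDF c z)) a :=
    (continuousAt_const.sub (continuousAt_screeningCost L ha)).add
      (continuousAt_const.mul (continuousAt_const.sub (continuousAt_betaCDF_param ha z)))
  rw [hVa] at hv
  filter_upwards [hc.eventually_const_lt hv, lt_mem_nhds ha] with c h1 h2
  exact h1.trans_le (hV c h2)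

lemma exists_forall_optValue_lt (hS : StationaryLoan ρ α δ K) :
    ∃ a, 0 < a ∧ ∀ b, 0 < b → b < a →
      optValue ρ α (survival (symmBeta a)) 0 < optValue ρ α (survival (symmBeta b)) 0 := by
  have ha : (0 : ℝ) < 1 / 4 := by norm_num
  obtain ⟨z, h, hz, -⟩ := exists_hasPeak_symmBeta ha hS.alpha_pos
  have h1 : 1 / 2 < z := by
    refine hz.2 ?_
    -- Here `α < 1` enters: the density at the mean is below `1/2`, so `(1 + α)` times it is below
    -- `1`.
    nlinarith [betaPDFReal_quarter_half_lt, hS.alpha_lt_one, hS.alpha_pos]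
  exact ⟨1 / 4, ha, fun b hb hba => (hS.optValue_le_of_half_le hb hba h h1.le).2 h1⟩

/-- If the value always decreased in the parameter, its value at `2` would be at least the
concentrated limit `K / 2`, and its value at `1` strictly more, against `optValue_symmBeta_le`. -/
lemma not_forall_optValue_lt (hS : StationaryLoan ρ α δ K) :
    ¬ ∀ a b, 0 < a → a < b →
      optValue ρ α (survival (symmBeta b)) 0 < optValue ρ α (survival (symmBeta a)) 0 := by
  intro hdec
  have hα := hS.alpha_pos
  have h1 := hdec 1 2 one_pos one_lt_two
  have h2 := hS.optValue_symmBeta_le (a := 1) one_pos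
  have h3 : ∀ y : ℝ, 0 ≤ y → y < 1 / 2 →
      K * y ≤ optValue ρ α (survival (symmBeta 2)) 0 := by
    intro y hy0 hy
    have ht : Filter.Tendsto (fun c => K * (y * survival (symmBeta c) y ^ (1 + α)))
        Filter.atTop (nhds (K * (y * 1 ^ (1 + α)))) :=
      (((tendsto_survival_symmBeta hy).rpow_const (Or.inl one_ne_zero)).const_mul y).const_mul K
    rw [Real.one_rpow, mul_one] at ht
    refine le_of_tendsto ht ?_
    filter_upwards [Filter.eventually_gt_atTop 2] with c hc
    have hG := isSurvival_symmBeta (a := c) (by linarith)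
    have := hS.static_le_optValue hG le_rfl hy0 (by linarith) (by rw [hG.zero]; exact one_pos)
    rw [hG.zero, Real.one_rpow, mul_one] at this
    exact this.trans (hdec 2 c two_pos hc).le
  have h4 : K * (1 / 2) ≤ optValue ρ α (survival (symmBeta 2)) 0 := by
    have ht : Filter.Tendsto (fun y : ℝ => K * y) (nhdsWithin (1 / 2) (Set.Iio (1 / 2)))
        (nhds (K * (1 / 2))) :=
      ((continuous_const.mul continuous_id).tendsto _).mono_left nhdsWithin_le_nhds
    refine le_of_tendsto ht ?_
    filter_upwards [Ioo_mem_nhdsLT (show (0 : ℝ) < 1 / 2 by norm_num)] with y hy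
    exact h3 y hy.1.le hy.2
  linarith

end StationaryLoan

/-! ### From quasiconvexity to the U-shape -/

/-- A strictly quasiconvex, lower semicontinuous function on the positive reals that is neither
strictly increasing near `0` nor strictly decreasing everywhere is U-shaped. -/
lemma exists_minimizer_of_strictQuasiconvex {V : ℝ → ℝ}
    (hq : ∀ a b c, 0 < b → b < a → a < c → V a < V b ∨ V a < V c)
    (hlsc : ∀ a v, 0 < a → v < V a → ∀ᶠ c in nhds a, v < V c)
    (hleft : ∃ a, 0 < a ∧ ∀ b, 0 < b → b < a → V a < V b)
    (hright : ¬ ∀ a b, 0 < a → a < b → V b < V a) :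
    ∃ m, 0 < m ∧ (∀ a b, 0 < a → a < b → b ≤ m → V b < V a) ∧
      ∀ a b, m ≤ a → a < b → V a < V b := by
  -- `D` collects the strict minima from the left. Quasiconvexity makes it an initial segment with
  -- `V` strictly increasing on its complement, so `m` is its supremum; semicontinuity is needed
  -- only at `m`.
  set D : Set ℝ := {a | 0 < a ∧ ∀ b, 0 < b → b < a → V a < V b} with hD
  have hinc : ∀ a c, 0 < a → a ∉ D → a < c → V a < V c ∧ c ∉ D := by
    intro a c ha haD hac
    have h1 : ∃ b, 0 < b ∧ b < a ∧ V b ≤ V a := by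
      by_contra! hcon
      exact haD ⟨ha, hcon⟩
    obtain ⟨b, hb, hba, hVb⟩ := h1
    have h2 := (hq a b c hb hba hac).resolve_left hVb.not_gt
    exact ⟨h2, fun hc => (hc.2 a ha hac).not_gt h2⟩
  have hDdown : ∀ a b, 0 < a → a < b → b ∈ D → a ∈ D := by
    intro a b ha hab hb
    by_contra haD
    exact (hinc a b ha haD hab).2 hb
  obtain ⟨a₀, ha₀⟩ := hleft
  have ha₀D : a₀ ∈ D := ha₀
  obtain ⟨c₀, hc₀, hc₀D⟩ : ∃ c, 0 < c ∧ c ∉ D := by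
    by_contra! hcon
    exact hright fun a b ha hab => (hcon b (ha.trans hab)).2 a ha hab
  have hbdd : BddAbove D := by
    refine ⟨c₀, fun d hd => ?_⟩
    by_contra! hcd
    exact hc₀D (hDdown c₀ d hc₀ hcd hd)
  set m := sSup D with hm
  have hm0 : 0 < m := ha₀.1.trans_le (le_csSup hbdd ha₀D)
  have hlt : ∀ a, 0 < a → a < m → a ∈ D := by
    intro a ha ham
    obtain ⟨d, hd, had⟩ := exists_lt_of_lt_csSup ⟨a₀, ha₀D⟩ ham
    exact hDdown a d ha had hd
  have hgt : ∀ a, m < a → a ∉ D := fun a ham haD => (le_csSup hbdd haD).not_gt ham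
  have hmL : ∀ a, 0 < a → a < m → V m ≤ V a := by
    intro a ha ham
    by_contra! hcon
    obtain ⟨ε, hε, hball⟩ := Metric.eventually_nhds_iff.1 (hlsc m (V a) hm0 hcon)
    obtain ⟨c, hc1, hc2⟩ := exists_between (max_lt ham (sub_lt_self m hε))
    have hac : a < c := (le_max_left _ _).trans_lt hc1
    have hcε : m - ε < c := (le_max_right _ _).trans_lt hc1
    have h1 := hball (y := c) (by rw [Real.dist_eq, abs_lt]; constructor <;> linarith)
    exact ((hlt c (ha.trans hac) hc2).2 a ha hac).not_gt h1
  have hmR : ∀ b, m < b → V m ≤ V b := by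
    intro b hmb
    by_contra! hcon
    obtain ⟨ε, hε, hball⟩ := Metric.eventually_nhds_iff.1 (hlsc m (V b) hm0 hcon)
    obtain ⟨c, hc1, hc2⟩ := exists_between (lt_min hmb (lt_add_of_pos_right m hε))
    have hcb : c < b := hc2.trans_le (min_le_left _ _)
    have hcε : c < m + ε := hc2.trans_le (min_le_right _ _)
    have h1 := hball (y := c) (by rw [Real.dist_eq, abs_lt]; constructor <;> linarith)
    exact ((hinc c b (hm0.trans hc1) (hgt c hc1) hcb).1).not_gt h1
  refine ⟨m, hm0, fun a b ha hab hbm => ?_, fun a b hma hab => ?_⟩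
  · rcases hbm.eq_or_lt with rfl | hbm
    · obtain ⟨c, hac, hcb⟩ := exists_between hab
      exact (hmL c (ha.trans hac) hcb).trans_lt ((hlt c (ha.trans hac) hcb).2 a ha hac)
    · exact (hlt b (ha.trans hab) hbm).2 a ha hab
  · rcases hma.eq_or_lt with rfl | hma
    · obtain ⟨c, hac, hcb⟩ := exists_between hab
      exact (hmR c hac).trans_lt (hinc c b (hm0.trans hac) (hgt c hac) hcb).1
    · exact (hinc a b (hm0.trans hma) (hgt a hma) hab).1

theorem proposition3 (ρ α : ℝ) (hρ : ρ ∈ Set.Ioo (0 : ℝ) 1) (hα : α ∈ Set.Ioo (0 : ℝ) 1) :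
    -- the mean, the variance, and the existence of the maximum that defines the optimal NPV
    (∀ a : ℝ, 0 < a →
      ∫ θ, θ ∂(symmBeta a) = 1 / 2 ∧
      incomeVar a = 1 / (4 * (2 * a + 1)) ∧
      (∀ p : LendingPolicy ρ,
        Summable (fun t => p.cashFlow (constElasticityDemand α) (symmBeta a) t)) ∧
      IsGreatest
        (Set.range fun p : LendingPolicy ρ =>
          p.expectedNPV (constElasticityDemand α) (symmBeta a))
        (optimalNPV ρ (constElasticityDemand α) (symmBeta a))) ∧
    -- as the variance increases, the optimal NPV first decreases and then increases
    ∃ v₀ ∈ Set.Ioo (0 : ℝ) (1 / 4), ∀ a b : ℝ, 0 < a → 0 < b → incomeVar a < incomeVar b →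
      (incomeVar b ≤ v₀ →
        optimalNPV ρ (constElasticityDemand α) (symmBeta b) <
          optimalNPV ρ (constElasticityDemand α) (symmBeta a)) ∧
      (v₀ ≤ incomeVar a →
        optimalNPV ρ (constElasticityDemand α) (symmBeta a) <
          optimalNPV ρ (constElasticityDemand α) (symmBeta b)) := by
  have hopt : ∀ a, 0 < a → optimalNPV ρ (constElasticityDemand α) (symmBeta a)
      = optValue ρ α (survival (symmBeta a)) 0 := fun a ha => by
    have := isProbabilityMeasure_symmBeta ha
    exact LendingPolicy.optimalNPV_eq_optValue hρ.1 hρ.2 hα.1 (isSurvival_symmBeta ha)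
  refine ⟨fun a ha => ?_, ?_⟩
  · have := isProbabilityMeasure_symmBeta ha
    refine ⟨integral_symmBeta_id ha, incomeVar_eq ha, fun p =>
      p.summable_cashFlow hρ.1 hρ.2 hα.1 (isSurvival_symmBeta ha), ?_⟩
    rw [hopt a ha]
    exact LendingPolicy.isGreatest_optValue hρ.1 hρ.2 hα.1 (isSurvival_symmBeta ha)
  · obtain ⟨δ, K, hS⟩ := exists_stationaryLoan hρ hα
    obtain ⟨m, hm, hdec, hincr⟩ := exists_minimizer_of_strictQuasiconvex
      (V := fun a => optValue ρ α (survival (symmBeta a)) 0)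
      (fun a b c hb hba hac => hS.optValue_lt_or_lt hb hba hac)
      (fun a v ha hv => hS.eventually_lt_optValue ha hv)
      hS.exists_forall_optValue_lt hS.not_forall_optValue_lt
    have hle : ∀ a b : ℝ, 0 < a → 0 < b →
        1 / (4 * (2 * a + 1)) ≤ 1 / (4 * (2 * b + 1)) → b ≤ a := fun a b ha hb h => by
      have := (one_div_le_one_div (by positivity) (by positivity)).1 h
      linarith
    refine ⟨1 / (4 * (2 * m + 1)), ⟨by positivity, ?_⟩, fun a b ha hb hab => ?_⟩
    · exact one_div_lt_one_div_of_lt (by norm_num) (by linarith)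
    · rw [incomeVar_eq ha, incomeVar_eq hb] at *
      have hba : b < a := by
        have := (one_div_lt_one_div (by positivity) (by positivity)).1 hab
        linarith
      rw [hopt a ha, hopt b hb]
      exact ⟨fun h => hincr b a (hle b m hb hm h) hba, fun h => hdec b a hb hba (hle m a hm ha h)⟩
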